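/- Let $M\ge 1$ be an integer and let $C>3$ be a real constant. For $k,\ell\in\mathbb{Z}_M$ and $x\in\mathbb{C}^M$ put $(\pi(k,\ell)x)(m)=e^{2\pi i\ell m/M}x(m-k)$. For a finite family of windows $G=(g_r)_{r}$ in $\mathbb{C}^M$ and a set $\Lambda\subset\mathbb{Z}_M\times\mathbb{Z}_M$, let $(G,\Lambda)$ be the multi-window Gabor family $(\pi(\lambda)g_r)_{r,\ \lambda\in\Lambda}$, and call it a phase retrievable frame if it spans $\mathbb{C}^M$ and the measurements $|\langle x,\pi(\lambda)g_r\rangle|^2$ determine every $x\in\mathbb{C}^M$ up to a global phase factor $e^{i\theta}$. For $P\subset\mathbb{Z}_M$ let $\mathbf{P}(P)=|P|/M$ and $\|P\|_u=\max_{m\neq 0}\bigl|\frac1M\sum_{j\in P}e^{-2\pi i jm/M}\bigr|$ (with $\|P\|_u=0$ if $M=1$), and let $$\beta(M,C)=\min\Bigl\{|P| : \emptyset\ne P\subset\mathbb{Z}_M,\ \|P\|_u\le \tfrac{C-3}{C-1}\,\mathbf{P}(P)\Bigr\}.$$ Let $T\subset\mathbb{Z}_M$ be any set with $|T|=\min\{\lfloor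 C\rfloor, M\}$ (so $|T|=C$ when $C$ is an integer with $C\le M$), and let $\Lambda=T\times\mathbb{Z}_M$. 1. There is a family $G$ of $1+3\beta(M,C)$ windows such that $(G,\Lambda)$ is a phase retrievable frame. The number of phaseless measurements is $|\Lambda|(1+3\beta(M,C))\le CM(1+3\beta(M,C))$; thus phase retrieval on $\mathbb{C}^M$ is possible from at most $CM(1+3\beta(M,C))$ phaseless multi-window Gabor measurements. 2. Let $Q=T-T$, let $P$ be any minimizer in the definition of $\beta(M,C)$, and let $g$ be uniformly distributed on the unit sphere of $\mathbb{C}^M$. Then, with probability $1$, $(G,\Lambda)$ is a phase retrievable frame for $G=\{g\}\cup\{g_{qpt}: q\in Q,\ p\in P,\ t\in\{0,1,2\}\}$, where $$g_{qpt}(m)=g(m)\Bigl(1+e^{2\pi i(mp/M+t/3)}\,\frac{g(m-q)}{g(m)}\Bigr);$$ this family consists of $|\Lambda|\,(1+3|T-T|\,\beta(M,C))$ vectors. -/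

import Mathlib

open scoped Pointwise
open MeasureTheory

noncomputable section

namespace GaborPhase

/-- The signal space `ℂ^M`, with coordinates indexed by `ℤ_M` and the Euclidean norm. -/
abbrev Signal (M : ℕ) : Type := EuclideanSpace ℂ (ZMod M)

/-- Translation: `(T_k x)(m) = x(m - k)`. -/
def translation {M : ℕ} (k : ZMod M) (x : Signal M) : Signal M :=
  WithLp.toLp 2 fun m => x (m - k)

/-- Modulation: `(M_ℓ x)(m) = e^{2πi ℓ m / M} x(m)`
(`ZMod.stdAddChar j` is `e^{2πi j / M}`). -/
def modulation {M : ℕ} [NeZero M] (l : ZMod M) (x : Signal M) : Signal M :=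
  WithLp.toLp 2 fun m => ZMod.stdAddChar (l * m) * x m

/-- Time-frequency shift: `π(k, ℓ) = M_ℓ T_k`. -/
def timeFreqShift {M : ℕ} [NeZero M] (lam : ZMod M × ZMod M) (x : Signal M) : Signal M :=
  modulation lam.2 (translation lam.1 x)

/-- The multi-window Gabor system `(G, Λ) = {π(λ) g_r}`, indexed by pairs (window index, `λ ∈ Λ`);
the number of measurements it provides is the cardinality of the index type. -/
def gaborSystem {M : ℕ} [NeZero M] {ι : Type*} (G : ι → Signal M)
    (Lam : Finset (ZMod M × ZMod M)) : ι × Lam → Signal M :=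
  fun j => timeFreqShift (j.2 : ZMod M × ZMod M) (G j.1)

/-- The phaseless measurements `|⟨x, φ_j⟩|²`, where `⟨x, φ⟩ = ∑ m, x(m) conj (φ(m))`. Mathlib's
`inner ℂ` is conjugate-linear in its first argument. -/
def phaselessMap {M : ℕ} [NeZero M] {ι : Type*} (Phi : ι → Signal M) (x : Signal M) : ι → ℝ :=
  fun j => ‖inner ℂ (Phi j) x‖ ^ 2

/-- A phase retrievable frame: a spanning family whose phaseless measurements determine every
signal up to a global phase factor `e^{iθ}`. -/
def IsPhaseRetrievable {M : ℕ} [NeZero M] {ι : Type*} (Phi : ι → Signal M) : Prop :=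
  Submodule.span ℂ (Set.range Phi) = ⊤ ∧
    ∀ x y : Signal M, phaselessMap Phi x = phaselessMap Phi y →
      ∃ θ : ℝ, y = Complex.exp (θ * Complex.I) • x

/-- The density `𝐏(A) = |A| / M` of a subset of `ℤ_M`. -/
def density {M : ℕ} (A : Finset (ZMod M)) : ℝ := (A.card : ℝ) / M

/-- The Fourier bias `‖A‖_u = max_{m ≠ 0} |F(1_A)(m)|`, with the normalized Fourier transform
`F(f)(m) = (1/M) ∑ j, f(j) e^{-2πi j m / M}` (`ZMod.dft` is the unnormalized one). For `M = 1`
the maximum is over the empty set and is `0`. -/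
def fourierBias {M : ℕ} [NeZero M] (A : Finset (ZMod M)) : ℝ :=
  ⨆ m : {m : ZMod M // m ≠ 0},
    ‖(M : ℂ)⁻¹ * ZMod.dft (fun j : ZMod M => if j ∈ A then (1 : ℂ) else 0) m‖

/-- The nonempty sets `P` with `‖P‖_u ≤ (C - 3) / (C - 1) * 𝐏(P)`. -/
def IsPseudorandom {M : ℕ} [NeZero M] (C : ℝ) (P : Finset (ZMod M)) : Prop :=
  P.Nonempty ∧ fourierBias P ≤ (C - 3) / (C - 1) * density P

/-- `β(M, C)`, the minimal size of a nonempty `P ⊆ ℤ_M` with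
`‖P‖_u ≤ (C - 3) / (C - 1) * 𝐏(P)`. -/
def beta (M : ℕ) [NeZero M] (C : ℝ) : ℕ :=
  sInf {n : ℕ | ∃ P : Finset (ZMod M), IsPseudorandom C P ∧ P.card = n}

/-- For `C > 3` the set in the definition of `beta` is nonempty, so the minimum is attained. -/
theorem beta_isLeast (M : ℕ) [NeZero M] (C : ℝ) (hC : 3 < C) :
    IsLeast {n : ℕ | ∃ P : Finset (ZMod M), IsPseudorandom C P ∧ P.card = n} (beta M C) := by
  have hne : {n : ℕ | ∃ P : Finset (ZMod M), IsPseudorandom C P ∧ P.card = n}.Nonempty := by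
    refine ⟨_, Finset.univ, ⟨Finset.univ_nonempty, ?_⟩, rfl⟩
    have h0 : fourierBias (Finset.univ : Finset (ZMod M)) = 0 := by
      unfold fourierBias
      have : ∀ m : {m : ZMod M // m ≠ 0}, ‖(M : ℂ)⁻¹ * ZMod.dft
          (fun j : ZMod M => if j ∈ (Finset.univ : Finset (ZMod M)) then (1 : ℂ) else 0) m‖
            = 0 := by
        rintro ⟨m, hm⟩
        have hs := AddChar.sum_mulShift (R := ZMod M) (R' := ℂ) (-m)
          (ZMod.isPrimitive_stdAddChar M)
        rw [if_neg (neg_ne_zero.mpr hm)] at hs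
        have : ZMod.dft (fun _ : ZMod M => (1 : ℂ)) m = 0 := by
          rw [ZMod.dft_apply]
          simpa [mul_comm] using hs
        simp [this]
      simp only [this]
      exact Real.iSup_const_zero
    rw [h0]
    have h1 : 0 ≤ (C - 3) / (C - 1) := div_nonneg (by linarith) (by linarith)
    exact mul_nonneg h1 (by unfold density; positivity)
  exact ⟨Nat.sInf_mem hne, fun n hn => Nat.sInf_le hn⟩

/-- The auxiliary window `g_{qpt} = g ⊙ s_{qpt}`, where
`s_{qpt}(m) = 1 + e^{2πi (m p / M + t / 3)} g(m - q) / g(m)`. -/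
def auxWindow {M : ℕ} [NeZero M] (g : Signal M) (q p : ZMod M) (t : Fin 3) : Signal M :=
  WithLp.toLp 2 fun m => g m *
    (1 + ZMod.stdAddChar (m * p) * Complex.exp (2 * Real.pi * Complex.I * ((t : ℕ) / 3 : ℂ)) *
      (g (m - q) / g m))

/-- The window family `{g} ∪ {g_{qpt} : q ∈ Q, p ∈ P, t ∈ {0, 1, 2}}`; it has `1 + 3 |Q| |P|`
members. -/
def windowFamily {M : ℕ} [NeZero M] (g : Signal M) (Q P : Finset (ZMod M)) :
    Option (Q × P × Fin 3) → Signal M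
  | none => g
  | some (q, p, t) => auxWindow g q p t

/-- The Lebesgue measure of `ℂ^M`. -/
def lebesgue (M : ℕ) [NeZero M] : Measure (Signal M) :=
  (volume : Measure (ZMod M → ℂ)).map (WithLp.toLp 2)

/-- The uniform probability distribution on the unit sphere of `ℂ^M`: the surface measure
divided by its total mass. -/
def uniformSphere (M : ℕ) [NeZero M] : Measure (Metric.sphere (0 : Signal M) 1) :=
  ((lebesgue M).toSphere Set.univ)⁻¹ • (lebesgue M).toSphere

end GaborPhase

end

namespace GaborPhase

/-! The statement about random windows is polarization on a graph. Write a_x(λ) = ⟨x, π(λ)g⟩. Up to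
a phase on the second term, π(k,l)g_{qpt} is π(k,l)g + π(k+q,l+p)g, so the three cube roots of unity
reveal conj(a_x(w)) a_x(v) along every edge v → w of Λ whose frequency difference lies in P. If x
and y have equal measurements, a_y/a_x is unimodular where a_x ≠ 0 and constant along the edges
there: it is a colouring. For almost every g any M time-frequency shifts form a basis, so fewer than
M vertices are lost, and a colour class with M vertices forces y = c x
(`isPhaseRetrievable_windowFamily`).

Such a class exists by `exists_large_color_class`. When ⌊C⌋ ≤ M, small classes could be merged into
two nearly equal parts with no edge from one to the other, which the small Fourier bias of P
excludes through expander mixing.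

General position (`ae_uniformSphere_generic`) asks that finitely many determinants, polynomial in g,
do not vanish identically. In `exists_det_gaborMatrix_ne_zero` a window made of powers of t
degenerates each of them, as t → 0, to a block Vandermonde determinant.

The existence statement does not use the graph: 1 + 3β ≥ 4, and four windows already suffice
(`exists_isPhaseRetrievable_of_four_le`). They sample |∑ x(m) z^m| at 2M points on each of two
concentric circles. This fixes two autocorrelation polynomials, and comparing the two radii fixes x
up to phase. -/

/-! ### Fourier analysis on ℤ_M and expander mixing. -/

open ComplexConjugate in
theorem conj_stdAddChar {M : ℕ} [NeZero M] (j : ZMod M) :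
    conj (ZMod.stdAddChar j : ℂ) = ZMod.stdAddChar (-j) :=
  (AddChar.map_neg_eq_conj _ _).symm

theorem norm_stdAddChar {M : ℕ} [NeZero M] (j : ZMod M) : ‖(ZMod.stdAddChar j : ℂ)‖ = 1 :=
  AddChar.norm_apply _ _

open ComplexConjugate in
/-- Parseval's identity on `ℤ_M`. -/
theorem sum_norm_sq_dft {M : ℕ} [NeZero M] (f : ZMod M → ℂ) :
    ∑ m, ‖ZMod.dft f m‖ ^ 2 = M * ∑ j, ‖f j‖ ^ 2 := by
  have conj_dft : ∀ m, conj (ZMod.dft f m) = ∑ j, ZMod.stdAddChar (j * m) * conj (f j) := by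
    intro m
    rw [ZMod.dft_apply, map_sum]
    refine Finset.sum_congr rfl fun j _ => ?_
    rw [smul_eq_mul, map_mul, conj_stdAddChar, neg_neg]
  have key : ∑ m, ZMod.dft f m * conj (ZMod.dft f m) = M * ∑ j, f j * conj (f j) := by
    calc ∑ m, ZMod.dft f m * conj (ZMod.dft f m)
        = ∑ m, ∑ j, conj (f j) * (ZMod.stdAddChar (j * m) * ZMod.dft f m) := by
          refine Finset.sum_congr rfl fun m _ => ?_
          rw [conj_dft, Finset.mul_sum]
          exact Finset.sum_congr rfl fun j _ => by ring
      _ = ∑ j, conj (f j) * ZMod.dft (ZMod.dft f) (-j) := by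
          rw [Finset.sum_comm]
          refine Finset.sum_congr rfl fun j _ => ?_
          rw [← Finset.mul_sum, ZMod.dft_apply (ZMod.dft f)]
          congr 1
          refine Finset.sum_congr rfl fun m _ => ?_
          rw [smul_eq_mul]
          congr 2
          ring
      _ = M * ∑ j, f j * conj (f j) := by
          rw [ZMod.dft_dft, Finset.mul_sum]
          refine Finset.sum_congr rfl fun j _ => ?_
          simp only [neg_neg, smul_eq_mul]
          ring
  simp only [Complex.mul_conj'] at key
  exact_mod_cast key

theorem norm_sum_stdAddChar_le {M : ℕ} [NeZero M] (P : Finset (ZMod M)) {m : ZMod M}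
    (hm : m ≠ 0) : ‖∑ p ∈ P, (ZMod.stdAddChar (p * m) : ℂ)‖ ≤ M * fourierBias P := by
  have hM : (0 : ℝ) < M := by exact_mod_cast NeZero.pos M
  -- The transform carries the sign e^{-2πi jm/M}, so the sum over P is its value at -m.
  have h := le_ciSup (f := fun m : {m : ZMod M // m ≠ 0} =>
    ‖(M : ℂ)⁻¹ * ZMod.dft (fun j : ZMod M => if j ∈ P then (1 : ℂ) else 0) m‖)
    (Set.finite_range _).bddAbove ⟨-m, neg_ne_zero.mpr hm⟩
  change _ ≤ fourierBias P at h
  have e : ZMod.dft (fun j : ZMod M => if j ∈ P then (1 : ℂ) else 0) (-m)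
      = ∑ p ∈ P, (ZMod.stdAddChar (p * m) : ℂ) := by
    rw [ZMod.dft_apply]
    simp [Finset.sum_ite_mem]
  simp only [e, norm_mul, norm_inv, Complex.norm_natCast] at h
  rwa [inv_mul_le_iff₀ hM] at h

theorem fourierBias_nonneg {M : ℕ} [NeZero M] (P : Finset (ZMod M)) : 0 ≤ fourierBias P :=
  Real.iSup_nonneg fun _ => norm_nonneg _

/-- Summing a mean-zero function over the translates of `P` contracts the `ℓ²` norm. -/
theorem sum_sq_sum_translates_le {M : ℕ} [NeZero M] (P : Finset (ZMod M)) (f : ZMod M → ℝ)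
    (hf : ∑ l, f l = 0) :
    ∑ l, (∑ p ∈ P, f (l + p)) ^ 2 ≤ (M * fourierBias P) ^ 2 * ∑ l, f l ^ 2 := by
  have hM : (0 : ℝ) < M := by exact_mod_cast NeZero.pos M
  set F : ZMod M → ℂ := fun l => f l with hF
  set H : ZMod M → ℂ := fun l => ∑ p ∈ P, F (l + p) with hH
  -- Summing over translates is a convolution, hence a Fourier multiplier. Frequency 0, where the
  -- multiplier is |P|, drops out because f has mean zero.
  have hdft : ∀ m, ZMod.dft H m = (∑ p ∈ P, (ZMod.stdAddChar (p * m) : ℂ)) * ZMod.dft F m := by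
    intro m
    rw [ZMod.dft_apply, Finset.sum_mul]
    simp only [hH, Finset.smul_sum]
    rw [Finset.sum_comm]
    refine Finset.sum_congr rfl fun p _ => ?_
    rw [ZMod.dft_apply, Finset.mul_sum]
    refine Fintype.sum_equiv (Equiv.addRight p) _ _ fun l => ?_
    simp only [Equiv.coe_addRight, smul_eq_mul]
    rw [← mul_assoc, ← AddChar.map_add_eq_mul]
    congr 2
    ring
  have h0 : ZMod.dft F 0 = 0 := by
    rw [ZMod.dft_apply_zero]
    simp only [hF]
    exact_mod_cast hf
  have hle : ∑ m, ‖ZMod.dft H m‖ ^ 2 ≤ ∑ m, (M * fourierBias P) ^ 2 * ‖ZMod.dft F m‖ ^ 2 := by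
    refine Finset.sum_le_sum fun m _ => ?_
    rw [hdft, norm_mul, mul_pow]
    by_cases hm : m = 0
    · simp [hm, h0]
    · gcongr
      exact norm_sum_stdAddChar_le P hm
  rw [← Finset.mul_sum, sum_norm_sq_dft, sum_norm_sq_dft, mul_left_comm] at hle
  have hle := le_of_mul_le_mul_left hle hM
  have e1 : ∀ l, ‖H l‖ ^ 2 = (∑ p ∈ P, f (l + p)) ^ 2 := by
    intro l
    have : H l = ((∑ p ∈ P, f (l + p) : ℝ) : ℂ) := by simp [hH, hF]
    rw [this, Complex.norm_real, Real.norm_eq_abs, sq_abs]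
  have e2 : ∀ l, ‖F l‖ ^ 2 = f l ^ 2 := by
    intro l
    simp only [hF, Complex.norm_real, Real.norm_eq_abs, sq_abs]
  simpa only [e1, e2] using hle

theorem sum_sub_mean_sq {M : ℕ} [NeZero M] (a : ZMod M → ℝ) :
    ∑ l, (a l - (∑ j, a j) / M) ^ 2 = ∑ l, a l ^ 2 - (∑ l, a l) ^ 2 / M := by
  have hM : (M : ℝ) ≠ 0 := by exact_mod_cast NeZero.ne M
  simp only [sub_sq, Finset.sum_add_distrib, Finset.sum_sub_distrib, ← Finset.mul_sum,
    ← Finset.sum_mul, Finset.sum_const, Finset.card_univ, ZMod.card, nsmul_eq_mul]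
  field_simp
  ring

/-- Expander mixing: weights `a`, `b` not joined by any step in `P` have small total mass. -/
theorem sq_mass_le_of_no_edges {M : ℕ} [NeZero M] (P : Finset (ZMod M)) (hP : P.Nonempty)
    {θ : ℝ} (hθ : fourierBias P ≤ θ * density P) (a b : ZMod M → ℝ)
    (h : ∀ l, ∀ p ∈ P, a l * b (l + p) = 0) :
    ((∑ l, a l) * ∑ l, b l) ^ 2 ≤ θ ^ 2 * (M * ∑ l, a l ^ 2 - (∑ l, a l) ^ 2) *
      (M * ∑ l, b l ^ 2 - (∑ l, b l) ^ 2) := by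
  have hM : (0 : ℝ) < M := by exact_mod_cast NeZero.pos M
  have hM' := hM.ne'
  set A := ∑ l, a l with hA
  set B := ∑ l, b l with hB
  have zero_mean : ∀ f : ZMod M → ℝ, ∑ l, (f l - (∑ j, f j) / M) = 0 := by
    intro f
    rw [Finset.sum_sub_distrib, Finset.sum_const, Finset.card_univ, ZMod.card, nsmul_eq_mul]
    field_simp
    ring
  -- Without edges the uncentred correlation is 0, so only the product of the means survives;
  -- Cauchy–Schwarz bounds it by the two variances.
  have hcorr : ∑ l, (a l - A / M) * ∑ p ∈ P, (b (l + p) - B / M) = - (P.card * (A * B) / M) := by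
    have e : ∀ l, (a l - A / M) * ∑ p ∈ P, (b (l + p) - B / M)
        = ∑ p ∈ P, (a l * b (l + p)) - (P.card * B / M) * a l
          - (A / M) * ∑ p ∈ P, b (l + p) + A / M * (P.card * B / M) := by
      intro l
      rw [Finset.sum_sub_distrib, Finset.sum_const, nsmul_eq_mul, ← Finset.mul_sum]
      ring
    have e' : ∑ l, ∑ p ∈ P, b (l + p) = P.card * B := by
      rw [Finset.sum_comm]
      rw [Finset.sum_congr rfl fun p _ =>
        Fintype.sum_equiv (Equiv.addRight p) (fun l => b (l + p)) b fun l => rfl]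
      rw [Finset.sum_const, nsmul_eq_mul]
    have e'' : ∑ l, ∑ p ∈ P, (a l * b (l + p)) = 0 :=
      Finset.sum_eq_zero fun l _ => Finset.sum_eq_zero fun p hp => h l p hp
    rw [Finset.sum_congr rfl fun l _ => e l, Finset.sum_add_distrib, Finset.sum_sub_distrib,
      Finset.sum_sub_distrib, e'', ← Finset.mul_sum, ← Finset.mul_sum, e', ← hA, Finset.sum_const,
      Finset.card_univ, ZMod.card, nsmul_eq_mul]
    field_simp
    ring
  have hCS := Finset.sum_mul_sq_le_sq_mul_sq Finset.univ (fun l => a l - A / M)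
    (fun l => ∑ p ∈ P, (b (l + p) - B / M))
  have hc := sum_sq_sum_translates_le P (fun l => b l - B / M) (zero_mean b)
  rw [sum_sub_mean_sq] at hc
  rw [hcorr, sum_sub_mean_sq] at hCS
  have hva : 0 ≤ ∑ l, a l ^ 2 - A ^ 2 / M := by
    rw [← sum_sub_mean_sq]; positivity
  have hvb : 0 ≤ ∑ l, b l ^ 2 - B ^ 2 / M := by
    rw [← sum_sub_mean_sq]; positivity
  have hbias : (M * fourierBias P) ^ 2 ≤ (θ * P.card) ^ 2 := by
    have h1 : M * fourierBias P ≤ θ * P.card := by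
      calc M * fourierBias P ≤ M * (θ * density P) := by gcongr
        _ = θ * P.card := by unfold density; field_simp
    have := fourierBias_nonneg P
    gcongr
  have hcard : (0 : ℝ) < P.card := by exact_mod_cast hP.card_pos
  have h1 : (P.card * (A * B) / M) ^ 2 ≤
      (∑ l, a l ^ 2 - A ^ 2 / M) * ((θ * P.card) ^ 2 * (∑ l, b l ^ 2 - B ^ 2 / M)) := by
    rw [neg_sq] at hCS
    refine hCS.trans (mul_le_mul_of_nonneg_left (hc.trans ?_) hva)
    exact mul_le_mul_of_nonneg_right hbias hvb
  have h2 : (P.card : ℝ) ^ 2 / M ^ 2 * (A * B) ^ 2 ≤ P.card ^ 2 / M ^ 2 *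
      (θ ^ 2 * (M * ∑ l, a l ^ 2 - A ^ 2) * (M * ∑ l, b l ^ 2 - B ^ 2)) := by
    calc (P.card : ℝ) ^ 2 / M ^ 2 * (A * B) ^ 2 = (P.card * (A * B) / M) ^ 2 := by ring
      _ ≤ _ := h1
      _ = _ := by field_simp
  exact le_of_mul_le_mul_left h2 (by positivity)

/-! ### Balanced splittings and large colour classes. -/

/-- Weights that are all at most `n` can be split into two parts of nearly equal mass. -/
theorem exists_balanced_subset {α : Type*} [DecidableEq α] (s : Finset α) (w : α → ℕ) (n : ℕ)
    (hw : ∀ c ∈ s, w c ≤ n) :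
    ∃ S ⊆ s, 2 * ∑ c ∈ S, w c ≤ ∑ c ∈ s, w c + n ∧ ∑ c ∈ s, w c ≤ 2 * ∑ c ∈ S, w c + n := by
  induction s using Finset.induction_on with
  | empty => exact ⟨∅, by simp⟩
  | insert c s hc ih =>
    obtain ⟨S, hS, h1, h2⟩ := ih fun d hd => hw d (Finset.mem_insert_of_mem hd)
    have hwc := hw c (Finset.mem_insert_self c s)
    have hcS : c ∉ S := fun h => hc (hS h)
    rw [Finset.sum_insert hc]
    -- Greedy choice: the new weight goes to the lighter side.
    by_cases h : 2 * ∑ c ∈ S, w c ≤ ∑ c ∈ s, w c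
    · refine ⟨insert c S, Finset.insert_subset_insert c hS, ?_⟩
      rw [Finset.sum_insert hcS]
      omega
    · exact ⟨S, hS.trans (Finset.subset_insert c s), by omega⟩

/-- Whole colour classes serve as the weights, so the splitting never cuts a colour. -/
theorem exists_balanced_union_of_color_classes {α β : Type*} [DecidableEq α] (V : Finset β)
    (u : β → α) (n : ℕ) (hn : ∀ c, (V.filter (u · = c)).card ≤ n) :
    ∃ S : Finset α, 2 * (V.filter (u · ∈ S)).card ≤ V.card + n ∧
      V.card ≤ 2 * (V.filter (u · ∈ S)).card + n := by
  obtain ⟨S, hS, h⟩ := exists_balanced_subset (V.image u) (fun c => (V.filter (u · = c)).card) n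
    fun c _ => hn c
  refine ⟨S, ?_⟩
  have e1 : V.card = ∑ c ∈ V.image u, (V.filter (u · = c)).card :=
    Finset.card_eq_sum_card_fiberwise fun v hv => Finset.mem_image_of_mem u hv
  have e2 : (V.filter (u · ∈ S)).card = ∑ c ∈ S, (V.filter (u · = c)).card := by
    rw [Finset.card_eq_sum_card_fiberwise (s := V.filter (u · ∈ S)) (f := u) (t := S)
      (fun v hv => (Finset.mem_filter.1 (Finset.mem_coe.1 hv)).2)]
    refine Finset.sum_congr rfl fun c hc => ?_
    rw [Finset.filter_filter]
    congr 1
    ext v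
    simp only [Finset.mem_filter]
    constructor
    · rintro ⟨h1, -, h2⟩; exact ⟨h1, h2⟩
    · rintro ⟨h1, h2⟩; exact ⟨h1, h2 ▸ hc, h2⟩
  rwa [e1, e2]

/-- Two subsets of `T × ℤ_M` with no edge `(k, l) → (k', l + p)`, `p ∈ P`, between them are
small. -/
theorem card_mul_card_le_of_no_edges {M : ℕ} [NeZero M] {T P : Finset (ZMod M)} (hP : P.Nonempty)
    {θ : ℝ} (hθ : fourierBias P ≤ θ * density P) {A B : Finset (ZMod M × ZMod M)}
    (hA : A ⊆ T ×ˢ Finset.univ) (hB : B ⊆ T ×ˢ Finset.univ)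
    (h : ∀ v ∈ A, ∀ w ∈ B, w.2 - v.2 ∉ P) :
    ((A.card : ℝ) * B.card) ^ 2 ≤ θ ^ 2 * (A.card * (T.card * M - A.card)) *
      (B.card * (T.card * M - B.card)) := by
  set wt : Finset (ZMod M × ZMod M) → ZMod M → ℝ := fun A l => (A.filter (·.2 = l)).card with hwt
  have sum_wt : ∀ A, ∑ l, wt A l = A.card := by
    intro A
    simp only [hwt]
    rw [Finset.card_eq_sum_card_fiberwise (f := Prod.snd) (t := Finset.univ)
      (fun v _ => by simp)]
    push_cast
    rfl
  have wt_le : ∀ A, A ⊆ T ×ˢ Finset.univ → ∀ l, wt A l ≤ T.card := by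
    intro A hA l
    simp only [hwt]
    norm_cast
    refine Finset.card_le_card_of_injOn Prod.fst ?_ ?_
    · intro v hv
      exact (Finset.mem_product.1 (hA (Finset.mem_filter.1 hv).1)).1
    · intro v hv w hw hvw
      exact Prod.ext hvw ((Finset.mem_filter.1 hv).2.trans (Finset.mem_filter.1 hw).2.symm)
  have var_le : ∀ A, A ⊆ T ×ˢ Finset.univ →
      M * ∑ l, wt A l ^ 2 - (∑ l, wt A l) ^ 2 ≤ A.card * (T.card * M - A.card) := by
    intro A hA
    have : ∑ l, wt A l ^ 2 ≤ T.card * A.card := by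
      rw [← sum_wt, Finset.mul_sum]
      refine Finset.sum_le_sum fun l _ => ?_
      rw [sq]
      exact mul_le_mul_of_nonneg_right (wt_le A hA l) (Nat.cast_nonneg _)
    rw [sum_wt]
    nlinarith [mul_le_mul_of_nonneg_left this (Nat.cast_nonneg (α := ℝ) M)]
  have var_nonneg : ∀ A, 0 ≤ M * ∑ l, wt A l ^ 2 - (∑ l, wt A l) ^ 2 := by
    intro A
    have hM : (0 : ℝ) < M := by exact_mod_cast NeZero.pos M
    have h1 : 0 ≤ ∑ l, (wt A l - (∑ j, wt A j) / M) ^ 2 := by positivity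
    rw [sum_sub_mean_sq] at h1
    have := mul_nonneg hM.le h1
    rwa [mul_sub, mul_div_cancel₀ _ hM.ne'] at this
  have key := sq_mass_le_of_no_edges P hP hθ (wt A) (wt B) ?_
  · rw [sum_wt, sum_wt] at key
    refine key.trans ?_
    have hA' := var_le A hA
    have hB' := var_le B hB
    have hA'' := var_nonneg A
    have hB'' := var_nonneg B
    rw [sum_wt] at hA' hB' hA'' hB''
    have hθ2 : 0 ≤ θ ^ 2 := sq_nonneg θ
    exact mul_le_mul (mul_le_mul_of_nonneg_left hA' hθ2) hB' hB''
      (mul_nonneg hθ2 (hA''.trans hA'))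
  · intro l p hp
    simp only [hwt]
    norm_cast
    by_contra hne
    rw [← ne_eq, mul_ne_zero_iff, Finset.card_ne_zero, Finset.card_ne_zero] at hne
    obtain ⟨⟨v, hv⟩, ⟨w, hw⟩⟩ := hne
    rw [Finset.mem_filter] at hv hw
    apply h v hv.1 w hw.1
    rw [hv.2, hw.2]
    simpa using hp

/-- Cancelling ab leaves ab ≤ θ²(KM - a)(KM - b), and (KM - a)(KM - b) ≤ KM² + ab, so Kθ ≤ K - 2
gives (4K - 4)ab ≤ (K - 2)²KM². But 4ab = (a + b)² - (a - b)² ≥ K(K - 2)M², and together these force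
K - 1 ≤ K - 2. -/
theorem balanced_split_contradiction {K M a b θ : ℝ} (hK : 3 ≤ K) (hM : 1 ≤ M) (hθ0 : 0 ≤ θ)
    (hθ : K * θ ≤ K - 2) (hN : (K - 1) * M + 1 ≤ a + b) (ha : a ≤ K * M)
    (hb : b ≤ K * M) (hab : a - b ≤ M) (hba : b - a ≤ M)
    (h : (a * b) ^ 2 ≤ θ ^ 2 * (a * (K * M - a)) * (b * (K * M - b))) : False := by
  have hKM : 2 * M ≤ (K - 1) * M := by nlinarith
  have ha0 : 0 < a := by linarith
  have hb0 : 0 < b := by linarith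
  have hxy : 0 ≤ (K * M - a) * (K * M - b) := mul_nonneg (by linarith) (by linarith)
  have h1 : a * b ≤ θ ^ 2 * ((K * M - a) * (K * M - b)) := by
    have : (a * b) * (a * b) ≤ (a * b) * (θ ^ 2 * ((K * M - a) * (K * M - b))) := by
      calc (a * b) * (a * b) = (a * b) ^ 2 := by ring
        _ ≤ _ := h
        _ = _ := by ring
    exact le_of_mul_le_mul_left this (mul_pos ha0 hb0)
  have hθ2 : K ^ 2 * θ ^ 2 ≤ (K - 2) ^ 2 := by
    rw [← mul_pow]
    gcongr
  have h2 : K ^ 2 * (a * b) ≤ (K - 2) ^ 2 * ((K * M - a) * (K * M - b)) := by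
    calc K ^ 2 * (a * b) ≤ K ^ 2 * (θ ^ 2 * ((K * M - a) * (K * M - b))) := by gcongr
      _ = (K ^ 2 * θ ^ 2) * ((K * M - a) * (K * M - b)) := by ring
      _ ≤ _ := by gcongr
  have h3 : (K * M - a) * (K * M - b) = K * M * (K * M - (a + b)) + a * b := by ring
  have h4 : K * M * (K * M - (a + b)) ≤ K * M * M := by
    have : 0 ≤ K * M := by positivity
    apply mul_le_mul_of_nonneg_left _ this
    linarith
  have h5 : (4 * K - 4) * (a * b) ≤ (K - 2) ^ 2 * (K * M * M) := by
    rw [h3] at h2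
    have := mul_le_mul_of_nonneg_left h4 (sq_nonneg (K - 2))
    nlinarith
  have h6 : K * (K - 2) * M ^ 2 ≤ 4 * (a * b) := by
    have e1 : ((K - 1) * M) ^ 2 ≤ (a + b) ^ 2 := by
      have : 0 ≤ (K - 1) * M := by linarith
      gcongr
      linarith
    have e2 : (a - b) ^ 2 ≤ M ^ 2 := sq_le_sq' (by linarith) hab
    nlinarith
  have h7 : (K - 1) * (K * (K - 2) * M ^ 2) ≤ (K - 2) ^ 2 * (K * M * M) := by
    refine le_trans (mul_le_mul_of_nonneg_left h6 (by linarith)) ?_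
    linarith
  have h8 : 0 < K * (K - 2) * M ^ 2 := by
    have : 0 < K - 2 := by linarith
    positivity
  nlinarith

/-- A colouring of most of `T × ℤ_M` that is constant along the edges `(k, l) → (k', l + p)`,
`p ∈ P`, has a colour class with at least `M` elements. -/
theorem exists_large_color_class {M : ℕ} [NeZero M] {C : ℝ} (hC : 3 < C) {T P : Finset (ZMod M)}
    (hT : T.card = min ⌊C⌋₊ M) (hP : IsPseudorandom C P) {α : Type*} [DecidableEq α]
    {V : Finset (ZMod M × ZMod M)} (hV : V ⊆ T ×ˢ Finset.univ)
    (hcard : T.card * M < V.card + M) (u : ZMod M × ZMod M → α)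
    (hu : ∀ v ∈ V, ∀ w ∈ V, w.2 - v.2 ∈ P → u v = u w) :
    ∃ c, M ≤ (V.filter (u · = c)).card := by
  have hMpos := NeZero.pos M
  have hVle : V.card ≤ T.card * M := by
    have := Finset.card_le_card hV
    rwa [Finset.card_product, Finset.card_univ, ZMod.card] at this
  set θ := (C - 3) / (C - 1) with hθ
  have hθ0 : 0 ≤ θ := div_nonneg (by linarith) (by linarith)
  rcases le_or_gt ⌊C⌋₊ M with hCM | hCM
  · rw [min_eq_left hCM] at hT
    by_contra! hsmall
    obtain ⟨S, hS1, hS2⟩ := exists_balanced_union_of_color_classes V u (M - 1)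
      fun c => Nat.le_sub_one_of_lt (hsmall c)
    set A := V.filter (u · ∈ S)
    set B := V.filter (fun v => ¬ u v ∈ S)
    have hABcard : A.card + B.card = V.card := Finset.card_filter_add_card_filter_not _
    have hAV : A ⊆ T ×ˢ Finset.univ := (Finset.filter_subset _ _).trans hV
    have hBV : B ⊆ T ×ˢ Finset.univ := (Finset.filter_subset _ _).trans hV
    have key := card_mul_card_le_of_no_edges hP.1 hP.2 hAV hBV (by
      intro v hv w hw hvw
      rw [Finset.mem_filter] at hv hw
      exact hw.2 (hu v hv.1 w hw.1 hvw ▸ hv.2))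
    have hK3 : 3 ≤ T.card := by
      rw [hT]
      exact Nat.le_floor (by exact_mod_cast hC.le)
    have hCK : C < T.card + 1 := by
      rw [hT]
      exact Nat.lt_floor_add_one C
    refine balanced_split_contradiction (K := T.card) (M := M) (a := A.card) (b := B.card) (θ := θ)
      (by exact_mod_cast hK3) (by exact_mod_cast hMpos) hθ0 ?_ ?_ ?_ ?_ ?_ ?_ key
    -- With K = ⌊C⌋, the bound Kθ ≤ K - 2 is equivalent to C ≤ K + 1; this is where the threshold (C
    -- - 3)/(C - 1) comes from.
    · rw [hθ, ← mul_div_assoc, div_le_iff₀ (by linarith)]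
      nlinarith
    · have : (T.card : ℝ) * M + 1 ≤ A.card + B.card + M := by exact_mod_cast (by omega)
      linarith
    · exact_mod_cast (by omega : A.card ≤ T.card * M)
    · exact_mod_cast (by omega : B.card ≤ T.card * M)
    · have : (A.card : ℝ) ≤ M + B.card := by exact_mod_cast (by omega)
      linarith
    · have : (B.card : ℝ) ≤ M + A.card := by exact_mod_cast (by omega)
      linarith
  -- Now |T| = M may be far below C, and Kθ ≤ K - 2 can fail. Instead V meets every frequency, so
  -- the frequencies S of one colour and R of the others cover ℤ_M. Mixing on a single layer, with M
  -- - |S| ≤ |R|, M - |R| ≤ |S| and θ < 1, makes R empty: there is only one colour.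
  · rw [min_eq_right hCM.le] at hT
    rw [hT] at hcard hVle
    have hθ1 : θ < 1 := by
      rw [hθ, div_lt_one (by linarith)]
      linarith
    have hMV : M ≤ V.card := by nlinarith [sq_nonneg ((M : ℤ) - 1)]
    obtain ⟨v₀, hv₀⟩ : V.Nonempty := Finset.card_pos.1 (by omega)
    refine ⟨u v₀, ?_⟩
    set c := u v₀
    set S : Finset (ZMod M) := (V.filter (u · = c)).image Prod.snd with hS
    set R : Finset (ZMod M) := (V.filter (fun v => ¬ u v = c)).image Prod.snd with hR
    have hcover : S ∪ R = Finset.univ := by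
      rw [Finset.eq_univ_iff_forall]
      intro l
      have : ∃ v ∈ V, v.2 = l := by
        by_contra! hl
        have hsub : V ⊆ (Finset.univ : Finset (ZMod M)) ×ˢ (Finset.univ.erase l) := by
          intro v hv
          simp [hl v hv]
        have := Finset.card_le_card hsub
        rw [Finset.card_product, Finset.card_erase_of_mem (Finset.mem_univ l), Finset.card_univ,
          ZMod.card, Nat.mul_sub_one] at this
        have : M ≤ M * M := Nat.le_mul_self M
        omega
      obtain ⟨v, hv, rfl⟩ := this
      rw [Finset.mem_union]
      by_cases h : u v = c
      · exact Or.inl (Finset.mem_image_of_mem _ (Finset.mem_filter.2 ⟨hv, h⟩))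
      · exact Or.inr (Finset.mem_image_of_mem _ (Finset.mem_filter.2 ⟨hv, h⟩))
    have hSR : M ≤ S.card + R.card := by
      have := Finset.card_union_le S R
      rwa [hcover, Finset.card_univ, ZMod.card] at this
    have hSpos : 0 < S.card := Finset.card_pos.2
      ⟨v₀.2, Finset.mem_image_of_mem _ (Finset.mem_filter.2 ⟨hv₀, rfl⟩)⟩
    have hSM : S.card ≤ M := by simpa [ZMod.card] using Finset.card_le_univ S
    have hRM : R.card ≤ M := by simpa [ZMod.card] using Finset.card_le_univ R
    have key := card_mul_card_le_of_no_edges (T := {0}) hP.1 hP.2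
      (A := {0} ×ˢ S) (B := {0} ×ˢ R)
      (Finset.product_subset_product_right (Finset.subset_univ _))
      (Finset.product_subset_product_right (Finset.subset_univ _)) (by
        rintro ⟨_, l⟩ hv ⟨_, l'⟩ hw hvw
        obtain ⟨v, hv', rfl⟩ := Finset.mem_image.1 (Finset.mem_product.1 hv).2
        obtain ⟨w, hw', rfl⟩ := Finset.mem_image.1 (Finset.mem_product.1 hw).2
        rw [Finset.mem_filter] at hv' hw'
        exact hw'.2 (hu v hv'.1 w hw'.1 hvw ▸ hv'.2))
    simp only [Finset.card_product, Finset.card_singleton, one_mul, Nat.cast_one] at key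
    have hR0 : R.card = 0 := by
      by_contra hRpos
      have hs : (0 : ℝ) < S.card := by exact_mod_cast hSpos
      have hr : (0 : ℝ) < R.card := by exact_mod_cast Nat.pos_of_ne_zero hRpos
      have hsr : (M : ℝ) ≤ S.card + R.card := by exact_mod_cast hSR
      have hsm : (S.card : ℝ) ≤ M := by exact_mod_cast hSM
      have hrm : (R.card : ℝ) ≤ M := by exact_mod_cast hRM
      have h1 : ((M : ℝ) - S.card) * (M - R.card) ≤ R.card * S.card :=
        mul_le_mul (by linarith) (by linarith) (by linarith) hr.le
      have h2 : θ ^ 2 < 1 := by nlinarith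
      have h3 : ((S.card : ℝ) * R.card) ^ 2 ≤ θ ^ 2 * ((S.card : ℝ) * R.card) ^ 2 := by
        calc ((S.card : ℝ) * R.card) ^ 2 ≤ _ := key
          _ = θ ^ 2 * (S.card * R.card * ((M - S.card) * (M - R.card))) := by ring
          _ ≤ θ ^ 2 * (S.card * R.card * (R.card * S.card)) := by gcongr
          _ = _ := by ring
      have h4 : 0 < ((S.card : ℝ) * R.card) ^ 2 := by positivity
      nlinarith
    have : V.filter (u · = c) = V := by
      rw [Finset.filter_eq_self]
      intro v hv
      by_contra h
      have : v.2 ∈ R := Finset.mem_image_of_mem _ (Finset.mem_filter.2 ⟨hv, h⟩)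
      rw [Finset.card_eq_zero.1 hR0] at this
      simp at this
    rwa [this]

/-! ### Nonvanishing Gabor determinants. -/

/-- The trapezoidal primitive of a sequence. -/
def trapezoid (κ : ℕ → ℤ) (n : ℕ) : ℤ := ∑ j ∈ Finset.range n, (κ j + κ (j + 1))

/-- The gap `2 (∫_i^m κ - (m - i) κ_i)` in the supporting line inequality for the convex function
`2 ∫ κ`. -/
def convexityGap (κ : ℕ → ℤ) (m i : ℕ) : ℤ :=
  trapezoid κ m - trapezoid κ i - 2 * (m - i) * κ i

/-- A primitive of a nondecreasing sequence is convex and lies above its supporting lines, touching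
one exactly where the slope has not changed. The induction runs on the distance between m and i, on
either side. -/
theorem convexityGap_nonneg_and {κ : ℕ → ℤ} (hκ : Monotone κ) (m i : ℕ) :
    0 ≤ convexityGap κ m i ∧ (convexityGap κ m i = 0 ↔ κ m = κ i) := by
  unfold convexityGap
  rcases le_total i m with h | h
  · obtain ⟨d, rfl⟩ := Nat.exists_eq_add_of_le h
    clear h
    induction d with
    | zero => simp
    | succ d ih =>
      have h1 : κ i ≤ κ (i + d) := hκ (by omega)
      have h2 : κ (i + d) ≤ κ (i + d + 1) := hκ (by omega)
      rw [← add_assoc, trapezoid, Finset.sum_range_succ, ← trapezoid]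
      push_cast at ih ⊢
      obtain ⟨h3, h4⟩ := ih
      refine ⟨by nlinarith, ?_, ?_⟩
      · intro h5
        nlinarith
      · intro h5
        have : κ (i + d) = κ i := by omega
        have := h4.2 this
        nlinarith
  · obtain ⟨d, rfl⟩ := Nat.exists_eq_add_of_le h
    clear h
    induction d with
    | zero => simp
    | succ d ih =>
      have h1 : κ m ≤ κ (m + d) := hκ (by omega)
      have h2 : κ (m + d) ≤ κ (m + d + 1) := hκ (by omega)
      rw [← add_assoc, trapezoid.eq_1 κ (m + d + 1), Finset.sum_range_succ, ← trapezoid]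
      push_cast at ih ⊢
      obtain ⟨h3, h4⟩ := ih
      -- Moving the point of tangency from m + d to m + d + 1 adds (2d + 1)(κ_{m+d+1} - κ_{m+d}) to
      -- the gap.
      have h6 : 0 ≤ (d : ℤ) * (κ (m + d + 1) - κ (m + d)) :=
        mul_nonneg (by omega) (by omega)
      refine ⟨by nlinarith, ?_, ?_⟩
      · intro h5
        have h7 : κ (m + d + 1) = κ (m + d) := by nlinarith
        rw [h7] at h5 ⊢
        exact h4.1 (by linarith)
      · intro h5
        have h7 : κ (m + d + 1) = κ (m + d) := by omega
        have := h4.2 (by omega)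
        rw [h7]
        nlinarith

theorem val_sub_eq {M : ℕ} [NeZero M] (x y : ZMod M) :
    ((x - y).val : ℤ) = x.val - y.val + if x.val < y.val then (M : ℤ) else 0 := by
  have hx := ZMod.val_lt x
  have hy := ZMod.val_lt y
  split_ifs with h
  · have e : x - y = ((x.val + M - y.val : ℕ) : ZMod M) := by
      rw [Nat.cast_sub (by omega)]
      simp
    rw [e, ZMod.val_natCast, Nat.mod_eq_of_lt (by omega)]
    omega
  · rw [ZMod.val_sub (by omega)]
    omega

/-- The cycle lemma: `M` points on a cycle of length `M` can be rotated so that every initial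
segment of length `j` contains at least `j` of them. -/
theorem exists_rotation {M : ℕ} [NeZero M] {ι : Type*} [Fintype ι] (hι : Fintype.card ι = M)
    (k : ι → ZMod M) :
    ∃ c : ZMod M, ∀ j ≤ M, j ≤ (Finset.univ.filter fun i => (k i - c).val < j).card := by
  obtain ⟨c, -, hc⟩ := Finset.exists_min_image Finset.univ (fun c => ∑ i, (k i - c).val)
    ⟨0, Finset.mem_univ _⟩
  refine ⟨c, fun j hj => ?_⟩
  rcases hj.eq_or_lt with rfl | hj
  · simp [ZMod.val_lt, hι]
  have h := hc (c + j) (Finset.mem_univ _)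
  -- Moving the origin by j lowers every distance by j and then raises by M those that were below j.
  -- Since c minimizes the total, at least j distances are below j.
  have e : ∑ i, ((k i - (c + j)).val : ℤ) = ∑ i, ((k i - c).val : ℤ) - M * j
      + M * (Finset.univ.filter fun i => (k i - c).val < j).card := by
    have : ∀ i, ((k i - (c + j)).val : ℤ)
        = (k i - c).val - j + if (k i - c).val < j then (M : ℤ) else 0 := by
      intro i
      rw [← sub_sub, val_sub_eq, ZMod.val_natCast, Nat.mod_eq_of_lt hj]
    simp only [this, Finset.sum_add_distrib, Finset.sum_sub_distrib, Finset.sum_const,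
      Finset.card_univ, hι, Finset.sum_ite, nsmul_eq_mul]
    ring
  have h' : ∑ i, ((k i - c).val : ℤ) ≤ ∑ i, ((k i - (c + j)).val : ℤ) := by exact_mod_cast h
  rw [e] at h'
  have hM : (0 : ℤ) < M := by exact_mod_cast NeZero.pos M
  have : (j : ℤ) ≤ (Finset.univ.filter fun i => (k i - c).val < j).card := by
    by_contra! hlt
    nlinarith
  exact_mod_cast this

/-- The matrix whose rows are the time-frequency shifts `π(e i) g`. -/
noncomputable def gaborMatrix {M : ℕ} [NeZero M] {ι : Type*} (e : ι → ZMod M × ZMod M) (g : Signal M) :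
    Matrix ι (ZMod M) ℂ :=
  Matrix.of fun i m => timeFreqShift (e i) g m

theorem timeFreqShift_apply {M : ℕ} [NeZero M] (k l : ZMod M) (g : Signal M) (m : ZMod M) :
    timeFreqShift (k, l) g m = ZMod.stdAddChar (l * m) * g (m - k) := rfl

/-- A block Vandermonde matrix with consecutive exponents in each block is invertible. -/
theorem det_block_vandermonde_ne_zero {M : ℕ} (κ : ℕ → ℤ) (hκ : Monotone κ) (x : Fin M → ℂ)
    (hx0 : ∀ i, x i ≠ 0) (hx : ∀ i j : Fin M, κ i = κ j → x i = x j → i = j) :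
    (Matrix.of fun i m : Fin M => if κ m = κ i then x i ^ (m : ℕ) else 0).det ≠ 0 := by
  intro hdet
  obtain ⟨w, hw0, hw⟩ := Matrix.exists_mulVec_eq_zero_iff.2 hdet
  apply hw0
  funext m₀
  set I : Finset (Fin M) := Finset.univ.filter fun i => κ i = κ m₀ with hI
  have hm₀ : m₀ ∈ I := by simp [hI]
  obtain ⟨a, ha, hmin⟩ := Finset.exists_min_image I (fun i : Fin M => (i : ℕ)) ⟨m₀, hm₀⟩
  set p : Polynomial ℂ := ∑ m ∈ I, Polynomial.C (w m) * Polynomial.X ^ ((m : ℕ) - a) with hp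
  have hdeg : p.natDegree < Fintype.card I := by
    rw [Fintype.card_coe]
    have hIpos : 0 < I.card := Finset.card_pos.2 ⟨m₀, hm₀⟩
    refine lt_of_le_of_lt (Polynomial.natDegree_sum_le_of_forall_le (n := I.card - 1) _ _ ?_)
      (by omega)
    intro m hm
    refine (Polynomial.natDegree_C_mul_X_pow_le _ _).trans ?_
    -- Monotonicity makes the block an interval of indices; after removal of X^a its exponents stay
    -- below its size, the number of its distinct nodes.
    have hsub : Finset.Icc a m ⊆ I := by
      intro i hi
      rw [Finset.mem_Icc] at hi
      have h1 : κ a ≤ κ i := hκ hi.1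
      have h2 : κ i ≤ κ m := hκ hi.2
      rw [hI, Finset.mem_filter] at ha hm ⊢
      exact ⟨Finset.mem_univ _, by omega⟩
    have := Finset.card_le_card hsub
    rw [Fin.card_Icc] at this
    omega
  have heval : ∀ i : I, p.eval (x i) = 0 := by
    rintro ⟨i, hi⟩
    have hwi := congrFun hw i
    simp only [Matrix.mulVec, dotProduct, Matrix.of_apply, Pi.zero_apply, ite_mul, zero_mul]
      at hwi
    rw [← Finset.sum_filter] at hwi
    have hiI := (Finset.mem_filter.1 hi).2
    rw [hiI, ← hI] at hwi
    have : x i ^ (a : ℕ) * p.eval (x i) = 0 := by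
      rw [← hwi, hp, Polynomial.eval_finsetSum, Finset.mul_sum]
      refine Finset.sum_congr rfl fun m hm => ?_
      simp only [Polynomial.eval_mul, Polynomial.eval_C, Polynomial.eval_pow, Polynomial.eval_X]
      rw [mul_left_comm, ← pow_add, Nat.add_sub_cancel' (hmin m hm), mul_comm]
    exact (mul_eq_zero.1 this).resolve_left (pow_ne_zero _ (hx0 i))
  have hp0 : p = 0 := Polynomial.eq_zero_of_natDegree_lt_card_of_eval_eq_zero p
    (f := fun i : I => x i) (fun i j hij => Subtype.ext (hx i j (by
      rw [(Finset.mem_filter.1 i.2).2, (Finset.mem_filter.1 j.2).2]) hij)) heval hdeg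
  have hcoeff : p.coeff ((m₀ : ℕ) - a) = w m₀ := by
    rw [hp, Polynomial.finsetSum_coeff, Finset.sum_eq_single m₀]
    · simp
    · intro m hm hne
      have h1 := hmin m hm
      have h2 := hmin m₀ hm₀
      rw [Polynomial.coeff_C_mul_X_pow, if_neg]
      intro h
      exact hne (Fin.ext (by omega))
    · intro h
      exact absurd hm₀ h
  rw [← hcoeff, hp0, Polynomial.coeff_zero, Pi.zero_apply]

/-- For g(m) = t^{m(m+M)} the quadratic exponent couples row i and column m only through -2mκ_i,
apart from wrap-around. Row and column factors turn this into a convexity gap, which vanishes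
exactly when κ_m = κ_i. At t = 0 what remains is block Vandermonde, with distinct nodes in each
block because e is injective. -/
theorem exists_det_gaborMatrix_ne_zero {M : ℕ} [NeZero M] (e : ZMod M → ZMod M × ZMod M)
    (he : Function.Injective e) : ∃ g : Signal M, (gaborMatrix e g).det ≠ 0 := by
  have hMpos := NeZero.pos M
  obtain ⟨c, hc⟩ := exists_rotation (ZMod.card M) fun i => (e i).1
  let τ : Fin M ≃ ZMod M := Fintype.equivOfCardEq (by simp [ZMod.card])
  let f : Fin M → ℕ := fun i => ((e (τ i)).1 - c).val
  let ρ : Fin M ≃ ZMod M := (Tuple.sort f).trans τ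
  have hmono : Monotone fun i => ((e (ρ i)).1 - c).val := Tuple.monotone_sort f
  let κ : ℕ → ℤ := fun n => ((e (ρ ⟨min n (M - 1), by omega⟩)).1 - c).val
  have hκmono : Monotone κ := by
    intro n n' h
    have := hmono (a := ⟨min n (M - 1), by omega⟩) (b := ⟨min n' (M - 1), by omega⟩)
      (by rw [Fin.mk_le_mk]; omega)
    exact Int.ofNat_le.2 this
  have hκ : ∀ i : Fin M, κ i = ((e (ρ i)).1 - c).val := by
    intro i
    have : (⟨min i (M - 1), by omega⟩ : Fin M) = i := Fin.ext (by simp; omega)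
    simp only [κ, this]
  -- The rotation c makes the sorted translations a parking function. Hence no entry of a diagonal
  -- block wraps around the cycle.
  have hparking : ∀ i : Fin M, κ i ≤ i := by
    intro i
    by_contra! hlt
    have h := hc (i + 1) i.2
    have hsub : (Finset.univ.filter fun j => ((e j).1 - c).val < (i : ℕ) + 1)
        ⊆ (Finset.Iio i).map ρ.toEmbedding := by
      intro j hj
      obtain ⟨j', rfl⟩ := ρ.surjective j
      rw [Finset.mem_filter] at hj
      refine Finset.mem_map_of_mem _ (Finset.mem_Iio.2 ?_)
      by_contra! hle
      have h1 : κ i ≤ κ j' := hκmono hle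
      rw [hκ j'] at h1
      omega
    have := Finset.card_le_card hsub
    rw [Finset.card_map, Fin.card_Iio] at this
    omega
  let x : Fin M → ℂ := fun i => ZMod.stdAddChar (e (ρ i)).2
  -- With d = m - κ_i < 0 the residue is d + M, and (d + M)(d + 2M) = d(d + M) + 2Md + 2M². The M in
  -- m(m + M) keeps this excess nonnegative.
  let wrap : ℕ → ℕ → ℤ := fun m i =>
    if (m : ℤ) < κ i then 2 * M * (m - κ i) + 2 * M ^ 2 else 0
  have hκlt : ∀ i : Fin M, κ i < M := by
    intro i
    have := hparking i
    omega
  have hκnonneg : ∀ n, 0 ≤ κ n := fun n => Int.natCast_nonneg _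
  have hwrap : ∀ m i : Fin M, 0 ≤ wrap m i := by
    intro m i
    simp only [wrap]
    split_ifs
    · have := hκlt i
      nlinarith
    · exact le_rfl
  let E : Fin M → Fin M → ℕ := fun m i => (convexityGap κ m i + wrap m i).toNat
  have hE : ∀ m i, (E m i : ℤ) = convexityGap κ m i + wrap m i := fun m i =>
    Int.toNat_of_nonneg (add_nonneg (convexityGap_nonneg_and hκmono _ _).1 (hwrap m i))
  have hE0 : ∀ m i, E m i = 0 ↔ κ m = κ i := by
    intro m i
    have h1 := convexityGap_nonneg_and hκmono m i
    have h2 := hwrap m i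
    have h3 := hE m i
    constructor
    · intro h
      exact h1.2.1 (by omega)
    · intro h
      have h4 := h1.2.2 h
      have h5 : wrap m i = 0 := by
        simp only [wrap]
        rw [if_neg]
        rw [← h]
        exact not_lt.2 (hparking m)
      omega
  let B : ℂ → Matrix (Fin M) (Fin M) ℂ := fun t => Matrix.of fun i m => x i ^ (m : ℕ) * t ^ E m i
  have hB0 : (B 0).det ≠ 0 := by
    have hB : B 0 = Matrix.of fun i m : Fin M => if κ m = κ i then x i ^ (m : ℕ) else 0 := by
      ext i m
      simp only [B, Matrix.of_apply, zero_pow_eq, hE0]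
      split_ifs <;> simp
    rw [hB]
    refine det_block_vandermonde_ne_zero κ hκmono x ?_ ?_
    · intro i h
      have := norm_stdAddChar (e (ρ i)).2
      simp only [x] at h
      rw [h, norm_zero] at this
      exact zero_ne_one this
    · intro i j h1 h2
      apply ρ.injective
      apply he
      refine Prod.ext ?_ (ZMod.injective_stdAddChar h2)
      rw [hκ, hκ] at h1
      exact sub_left_injective (ZMod.val_injective M (by exact_mod_cast h1))
  have hcont : Continuous fun t => (B t).det := by
    refine Continuous.matrix_det (continuous_matrix fun i m => ?_)
    simp only [B, Matrix.of_apply]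
    fun_prop
  -- A nonzero t close to 0 is needed, since t = 0 would destroy the row and column factors.
  obtain ⟨t, ht, ht0⟩ : ∃ t : ℂ, (B t).det ≠ 0 ∧ t ≠ 0 :=
    ((hcont.continuousAt.eventually_ne hB0).filter_mono nhdsWithin_le_nhds |>.and
      (eventually_mem_nhdsWithin (a := (0 : ℂ)) (s := {0}ᶜ))).exists
  let φ : Fin M ≃ ZMod M := Equiv.ofBijective (fun i => ((i : ℕ) : ZMod M) + c) (by
    rw [Fintype.bijective_iff_injective_and_card]
    refine ⟨fun i j h => ?_, by simp [ZMod.card]⟩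
    have h' : ((i : ℕ) : ZMod M) = ((j : ℕ) : ZMod M) := add_right_cancel h
    have := congrArg ZMod.val h'
    rw [ZMod.val_natCast, ZMod.val_natCast, Nat.mod_eq_of_lt i.2, Nat.mod_eq_of_lt j.2] at this
    exact Fin.ext this)
  let g : Signal M := WithLp.toLp 2 fun m => t ^ (m.val * (m.val + M))
  refine ⟨g, ?_⟩
  let r : Fin M → ℂ := fun m => t ^ ((m : ℤ) ^ 2 + M * m - trapezoid κ m)
  let s : Fin M → ℂ := fun i => ZMod.stdAddChar ((e (ρ i)).2 * c) *
    t ^ (κ i ^ 2 - M * κ i + trapezoid κ i - 2 * i * κ i)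
  have hfact : (gaborMatrix e g).submatrix ρ φ
      = Matrix.diagonal s * B t * Matrix.diagonal r := by
    ext i m
    rw [Matrix.mul_diagonal, Matrix.diagonal_mul]
    have hval : (((φ m - (e (ρ i)).1).val : ℕ) : ℤ)
        = m - κ i + if (m : ℤ) < κ i then (M : ℤ) else 0 := by
      have : φ m - (e (ρ i)).1 = ((m : ℕ) : ZMod M) - ((e (ρ i)).1 - c) := by
        simp only [φ, Equiv.ofBijective_apply]
        ring
      rw [this, val_sub_eq, ZMod.val_natCast, Nat.mod_eq_of_lt m.2, hκ]
      simp only [Nat.cast_lt]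
    have hexp : (((φ m - (e (ρ i)).1).val * ((φ m - (e (ρ i)).1).val + M) : ℕ) : ℤ)
        = (κ i ^ 2 - M * κ i + trapezoid κ i - 2 * i * κ i) + E m i
          + ((m : ℤ) ^ 2 + M * m - trapezoid κ m) := by
      rw [Nat.cast_mul, Nat.cast_add, hval, hE]
      simp only [wrap, convexityGap]
      split_ifs <;> ring
    have hchar : (ZMod.stdAddChar ((e (ρ i)).2 * φ m) : ℂ)
        = ZMod.stdAddChar ((e (ρ i)).2 * c) * x i ^ (m : ℕ) := by
      simp only [x, φ, Equiv.ofBijective_apply]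
      rw [← AddChar.map_nsmul_eq_pow, ← AddChar.map_add_eq_mul, nsmul_eq_mul]
      congr 1
      ring
    have hg : g (φ m - (e (ρ i)).1) = t ^ (κ i ^ 2 - M * κ i + trapezoid κ i - 2 * i * κ i)
        * t ^ E m i * r m := by
      simp only [g, r]
      rw [← zpow_natCast, ← zpow_natCast, ← zpow_add₀ ht0, ← zpow_add₀ ht0, ← hexp]
    change ZMod.stdAddChar ((e (ρ i)).2 * φ m) * g (φ m - (e (ρ i)).1) = _
    rw [hchar, hg]
    simp only [s, B, Matrix.of_apply]
    ring
  have hunit : IsUnit ((gaborMatrix e g).submatrix ρ φ) := by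
    rw [Matrix.isUnit_iff_isUnit_det, isUnit_iff_ne_zero, hfact, Matrix.det_mul, Matrix.det_mul,
      Matrix.det_diagonal, Matrix.det_diagonal]
    refine mul_ne_zero (mul_ne_zero (Finset.prod_ne_zero_iff.2 fun i _ => ?_) ht)
      (Finset.prod_ne_zero_iff.2 fun m _ => zpow_ne_zero _ ht0)
    refine mul_ne_zero (norm_ne_zero_iff.1 ?_) (zpow_ne_zero _ ht0)
    rw [norm_stdAddChar]
    exact one_ne_zero
  rw [Matrix.isUnit_submatrix_equiv, Matrix.isUnit_iff_isUnit_det, isUnit_iff_ne_zero] at hunit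
  exact hunit

/-! ### Generic windows on the sphere. -/

instance lebesgue_isAddHaarMeasure (M : ℕ) [NeZero M] : (lebesgue M).IsAddHaarMeasure :=
  (PiLp.continuousLinearEquiv 2 ℝ fun _ : ZMod M => ℂ).symm.isAddHaarMeasure_map
    (volume : Measure (ZMod M → ℂ))

/-- A continuous homogeneous function whose restrictions to all lines in some direction have
finitely many zeros is nonzero almost everywhere on the unit sphere. -/
theorem ae_uniformSphere_ne_zero {M : ℕ} [NeZero M] (F : Signal M → ℂ) (hF : Continuous F)
    (hhom : ∀ (r : ℝ) x, F x = 0 → F (r • x) = 0) (v : Signal M)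
    (hv : ∀ y, {t : ℂ | F (y + t • v) = 0}.Finite) :
    ∀ᵐ g : Metric.sphere (0 : Signal M) 1 ∂(uniformSphere M), F g ≠ 0 := by
  have hopen : IsOpen {x | F x ≠ 0} := isOpen_ne_fun hF continuous_const
  have hae : ∀ᵐ x ∂(lebesgue M), x ∈ {x | F x ≠ 0} := by
    -- Fubini along complex lines in direction v: each line meets the zero set in finitely many
    -- points.
    refine ae_mem_of_ae_add_linearMap_mem (LinearMap.toSpanSingleton ℂ (Signal M) v)
      (volume : Measure ℂ) (lebesgue M) hopen.measurableSet fun y => ?_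
    rw [ae_iff]
    refine measure_mono_null ?_ ((hv y).measure_zero volume)
    intro t ht
    simpa using ht
  have hnull : lebesgue M {x | F x = 0} = 0 := by
    rw [ae_iff] at hae
    simpa using hae
  have hsphere : (lebesgue M).toSphere {g | F g = 0} = 0 := by
    have hclosed : IsClosed {g : Metric.sphere (0 : Signal M) 1 | F g = 0} :=
      isClosed_eq (hF.comp continuous_subtype_val) continuous_const
    -- The surface measure of a set is a multiple of the Lebesgue measure of the cone over it, and
    -- homogeneity keeps that cone inside the zero set of F.
    rw [Measure.toSphere_apply' _ hclosed.measurableSet]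
    rw [measure_mono_null _ hnull, mul_zero]
    rintro _ ⟨r, -, _, ⟨g, hg, rfl⟩, rfl⟩
    exact hhom r g hg
  rw [uniformSphere]
  refine Measure.ae_smul_measure ?_ _
  rw [ae_iff]
  simpa using hsphere

theorem gaborMatrix_add {M : ℕ} [NeZero M] {ι : Type*} (e : ι → ZMod M × ZMod M)
    (g h : Signal M) : gaborMatrix e (g + h) = gaborMatrix e g + gaborMatrix e h := by
  ext i m
  exact mul_add _ _ _

theorem gaborMatrix_smul {M : ℕ} [NeZero M] {ι : Type*} (e : ι → ZMod M × ZMod M) (c : ℂ)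
    (g : Signal M) : gaborMatrix e (c • g) = c • gaborMatrix e g := by
  ext i m
  exact mul_left_comm _ _ _

theorem continuous_gaborMatrix {M : ℕ} [NeZero M] {ι : Type*} (e : ι → ZMod M × ZMod M) :
    Continuous fun g : Signal M => gaborMatrix e g := by
  refine continuous_matrix fun i m => ?_
  change Continuous fun g : Signal M => ZMod.stdAddChar ((e i).2 * m) * g (m - (e i).1)
  fun_prop

/-- As a polynomial in t the determinant has coefficient det B at t^n, where n is the matrix size,
so it is not the zero polynomial. -/
theorem finite_setOf_det_add_smul_eq_zero {n : Type*} [Fintype n] [DecidableEq n]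
    (A B : Matrix n n ℂ) (hB : B.det ≠ 0) : {t : ℂ | (A + t • B).det = 0}.Finite := by
  set p : Polynomial ℂ :=
    ((Polynomial.X : Polynomial ℂ) • B.map Polynomial.C + A.map Polynomial.C).det with hp
  have hp0 : p ≠ 0 := by
    intro h
    apply hB
    rw [← Polynomial.coeff_det_X_add_C_card B A, ← hp, h, Polynomial.coeff_zero]
  refine (Polynomial.finite_setOfPred_isRoot hp0).subset fun t ht => ?_
  change p.eval t = 0
  have heval : (Polynomial.evalRingHom t).mapMatrix
      ((Polynomial.X : Polynomial ℂ) • B.map Polynomial.C + A.map Polynomial.C) = A + t • B := by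
    ext i j
    simp [add_comm, mul_comm (B i j) t]
  rw [hp, ← Polynomial.coe_evalRingHom, RingHom.map_det, heval]
  exact ht

/-- Almost every window on the sphere has no zeros and generates a Gabor system in general linear
position. -/
theorem ae_uniformSphere_generic (M : ℕ) [NeZero M] :
    ∀ᵐ g : Metric.sphere (0 : Signal M) 1 ∂(uniformSphere M),
      (∀ m, (g : Signal M) m ≠ 0) ∧ ∀ e : ZMod M → ZMod M × ZMod M, Function.Injective e →
        (gaborMatrix e (g : Signal M)).det ≠ 0 := by
  refine Filter.Eventually.and ?_ ?_
  · rw [ae_all_iff]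
    intro m
    refine ae_uniformSphere_ne_zero (fun g => g m) (by fun_prop)
      (fun r x hx => by simp [hx]) (WithLp.toLp 2 fun _ => 1) fun y => ?_
    refine (Set.finite_singleton (-(y m))).subset fun t ht => ?_
    simp only [Set.mem_ofPred_eq, PiLp.add_apply, PiLp.smul_apply, smul_eq_mul, mul_one] at ht
    exact eq_neg_of_add_eq_zero_right ht
  -- There are only finitely many selections e, so each may use its own direction v.
  · rw [ae_all_iff]
    intro e
    rw [ae_all_iff]
    intro he
    obtain ⟨v, hv⟩ := exists_det_gaborMatrix_ne_zero e he
    refine ae_uniformSphere_ne_zero (fun g => (gaborMatrix e g).det)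
      (continuous_gaborMatrix e).matrix_det (fun r x hx => ?_) v fun y => ?_
    · rw [← Complex.coe_smul r x, gaborMatrix_smul, Matrix.det_smul, hx, mul_zero]
    · simp only [gaborMatrix_add, gaborMatrix_smul]
      exact finite_setOf_det_add_smul_eq_zero _ _ hv

/-! ### Polarization and propagation of the phase. -/

/-- For a window in general linear position, a signal orthogonal to `M` of its time-frequency
shifts vanishes. -/
theorem eq_zero_of_inner_timeFreqShift_eq_zero {M : ℕ} [NeZero M] {g : Signal M}
    (hg : ∀ e : ZMod M → ZMod M × ZMod M, Function.Injective e → (gaborMatrix e g).det ≠ 0)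
    {W : Finset (ZMod M × ZMod M)} (hW : M ≤ W.card) {x : Signal M}
    (hx : ∀ lam ∈ W, inner ℂ (timeFreqShift lam g) x = 0) : x = 0 := by
  obtain ⟨e⟩ : Nonempty (ZMod M ↪ W) := Function.Embedding.nonempty_of_card_le
    (by simpa [ZMod.card] using hW)
  have hdet := hg (fun i => e i) (Subtype.val_injective.comp e.injective)
  -- The rows are not conjugated, so orthogonality says that the conjugate of x lies in the kernel.
  have h : (gaborMatrix (fun i => (e i : ZMod M × ZMod M)) g).mulVec (fun m => star (x m)) = 0 := by
    funext i
    have := hx (e i) (e i).2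
    rw [← inner_conj_symm, map_eq_zero, PiLp.inner_apply] at this
    rw [Pi.zero_apply, ← this]
    refine Finset.sum_congr rfl fun m _ => ?_
    rw [RCLike.inner_apply]
    rfl
  have h0 := Matrix.eq_zero_of_mulVec_eq_zero hdet h
  ext m
  exact star_eq_zero.1 (congrFun h0 m)

/-- Injectivity of the phaseless measurements up to a unimodular factor already forces the family
to span. -/
theorem isPhaseRetrievable_of_injective {M : ℕ} [NeZero M] {ι : Type*} (Phi : ι → Signal M)
    (h : ∀ x y : Signal M, phaselessMap Phi x = phaselessMap Phi y → ∃ c : ℂ, ‖c‖ = 1 ∧ y = c • x) :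
    IsPhaseRetrievable Phi := by
  refine ⟨?_, fun x y hxy => ?_⟩
  · rw [← Submodule.orthogonal_eq_bot_iff, Submodule.eq_bot_iff]
    intro x hx
    obtain ⟨c, -, hc⟩ := h 0 x (by
      funext j
      simp [phaselessMap, hx (Phi j) (Submodule.subset_span (Set.mem_range_self j))])
    rw [hc, smul_zero]
  · obtain ⟨c, hc, hy⟩ := h x y hxy
    refine ⟨c.arg, ?_⟩
    have := Complex.norm_mul_exp_arg_mul_I c
    rw [hc, Complex.ofReal_one, one_mul] at this
    rw [this, hy]

/-- Since g has no zeros, the second summand of the window is a cube root of unity times π(q,p)g;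
commuting π(k,l) past the modulation by p costs the phase e^{-2πi kp/M}. -/
theorem timeFreqShift_auxWindow {M : ℕ} [NeZero M] {g : Signal M} (hg : ∀ m, g m ≠ 0)
    (k l q p : ZMod M) (t : Fin 3) :
    timeFreqShift (k, l) (auxWindow g q p t) = timeFreqShift (k, l) g +
      (ZMod.stdAddChar (-(k * p)) *
        Complex.exp (2 * Real.pi * Complex.I * ((t : ℕ) / 3 : ℂ))) •
          timeFreqShift (k + q, l + p) g := by
  ext m
  rw [PiLp.add_apply, PiLp.smul_apply, timeFreqShift_apply, timeFreqShift_apply,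
    timeFreqShift_apply]
  have h1 : (ZMod.stdAddChar ((l + p) * m) : ℂ) * ZMod.stdAddChar (-(k * p))
      = ZMod.stdAddChar (l * m) * ZMod.stdAddChar ((m - k) * p) := by
    rw [← AddChar.map_add_eq_mul, ← AddChar.map_add_eq_mul]
    congr 1
    ring
  have h2 : m - (k + q) = m - k - q := by ring
  have h3 := hg (m - k)
  simp only [auxWindow, smul_eq_mul]
  rw [h2]
  generalize Complex.exp (2 * Real.pi * Complex.I * ((t : ℕ) / 3 : ℂ)) = ω
  field_simp
  linear_combination (-(ω * g (m - k - q))) * h1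

open ComplexConjugate in
/-- Three-point polarization: the magnitudes of `z + \bar v ω^{-t} w` for the cube roots of unity
`ω^t` determine `\bar w z`. -/
theorem conj_mul_eq_of_norm_add_cube_roots {v z w z' w' : ℂ} (hv : v ≠ 0)
    (h : ∀ t : Fin 3,
      ‖z + conj (v * Complex.exp (2 * Real.pi * Complex.I * ((t : ℕ) / 3 : ℂ))) * w‖ ^ 2 =
      ‖z' + conj (v * Complex.exp (2 * Real.pi * Complex.I * ((t : ℕ) / 3 : ℂ))) * w'‖ ^ 2) :
    conj w * z = conj w' * z' := by
  have hcos : Real.cos (2 * Real.pi / 3) = -(1 / 2) := by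
    rw [show 2 * Real.pi / 3 = Real.pi - Real.pi / 3 by ring, Real.cos_pi_sub,
      Real.cos_pi_div_three]
  have hsin : Real.sin (2 * Real.pi / 3) = √3 / 2 := by
    rw [show 2 * Real.pi / 3 = Real.pi - Real.pi / 3 by ring, Real.sin_pi_sub,
      Real.sin_pi_div_three]
  have e1 : Complex.exp (2 * Real.pi * Complex.I * (((1 : Fin 3) : ℕ) / 3 : ℂ))
      = ⟨-(1 / 2), √3 / 2⟩ := by
    rw [show 2 * Real.pi * Complex.I * (((1 : Fin 3) : ℕ) / 3 : ℂ)
      = ((2 * Real.pi / 3 : ℝ) : ℂ) * Complex.I by push_cast; simp; ring]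
    apply Complex.ext
    · rw [Complex.exp_ofReal_mul_I_re, hcos]
    · rw [Complex.exp_ofReal_mul_I_im, hsin]
  have e2 : Complex.exp (2 * Real.pi * Complex.I * (((2 : Fin 3) : ℕ) / 3 : ℂ))
      = ⟨-(1 / 2), -(√3 / 2)⟩ := by
    rw [show 2 * Real.pi * Complex.I * (((2 : Fin 3) : ℕ) / 3 : ℂ)
      = 2 * Real.pi * Complex.I - ((2 * Real.pi / 3 : ℝ) : ℂ) * Complex.I by
        push_cast; simp; ring, Complex.exp_sub, Complex.exp_two_pi_mul_I, one_div,
      ← Complex.exp_neg, ← neg_mul, ← Complex.ofReal_neg]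
    apply Complex.ext
    · rw [Complex.exp_ofReal_mul_I_re, Real.cos_neg, hcos]
    · rw [Complex.exp_ofReal_mul_I_im, Real.sin_neg, hsin]
  have h0 := h 0
  have h1 := h 1
  have h2 := h 2
  rw [e1] at h1
  rw [e2] at h2
  have e0 : Complex.exp (2 * Real.pi * Complex.I * (((0 : Fin 3) : ℕ) / 3 : ℂ)) = 1 := by simp
  rw [e0, mul_one] at h0
  -- With X = v · conj b · a the cross term is 2 Re(Xc). Over the cube roots c, the sum of the three
  -- equations isolates the constant term, c = 1 then gives Re X, and the difference of the other
  -- two gives √3 Im X.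
  have expand : ∀ c a b : ℂ, ‖a + conj (v * c) * b‖ ^ 2
      = ‖a‖ ^ 2 + ‖v‖ ^ 2 * ‖c‖ ^ 2 * ‖b‖ ^ 2 +
        2 * ((v * (conj b * a)).re * c.re - (v * (conj b * a)).im * c.im) := by
    intro c a b
    simp only [← Complex.normSq_eq_norm_sq, Complex.normSq_apply, Complex.add_re, Complex.add_im,
      Complex.mul_re, Complex.mul_im, Complex.conj_re, Complex.conj_im]
    ring
  have n1 : ‖(⟨-(1 / 2), √3 / 2⟩ : ℂ)‖ ^ 2 = 1 := by
    rw [← Complex.normSq_eq_norm_sq, Complex.normSq_mk]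
    nlinarith [Real.mul_self_sqrt (show (0 : ℝ) ≤ 3 by norm_num)]
  have n2 : ‖(⟨-(1 / 2), -(√3 / 2)⟩ : ℂ)‖ ^ 2 = 1 := by
    rw [← Complex.normSq_eq_norm_sq, Complex.normSq_mk]
    nlinarith [Real.mul_self_sqrt (show (0 : ℝ) ≤ 3 by norm_num)]
  have h0' := (expand 1 z w).symm.trans ((by simpa using h0 :
    ‖z + conj (v * 1) * w‖ ^ 2 = ‖z' + conj (v * 1) * w'‖ ^ 2).trans (expand 1 z' w'))
  rw [expand, expand, n1] at h1
  rw [expand, expand, n2] at h2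
  simp only [norm_one, Complex.one_re, Complex.one_im] at h0' h1 h2
  have hsqrt : (0 : ℝ) < √3 := Real.sqrt_pos.2 (by norm_num)
  have hre : (v * (conj w * z)).re = (v * (conj w' * z')).re := by linarith
  have him : (v * (conj w * z)).im = (v * (conj w' * z')).im := by
    have : √3 * ((v * (conj w * z)).im - (v * (conj w' * z')).im) = 0 := by linarith
    linarith [(mul_eq_zero.1 this).resolve_left hsqrt.ne']
  exact mul_left_cancel₀ hv (Complex.ext hre him)

-- b|a'|² = b|b'|² = b' conj(b') b = b' conj(a') a, and conj(a') cancels. This carries the ratio of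
-- coefficients across an edge.
open ComplexConjugate in
theorem div_eq_div_of_norm_eq_of_conj_mul_eq {a a' b b' : ℂ} (ha : a ≠ 0) (ha' : a' ≠ 0)
    (hn : ‖a'‖ = ‖b'‖) (h : conj a' * a = conj b' * b) : b / a = b' / a' := by
  have h1 : a' * conj a' = b' * conj b' := by rw [Complex.mul_conj', Complex.mul_conj', hn]
  rw [div_eq_div_iff ha ha']
  apply mul_left_cancel₀ ((map_ne_zero (starRingEnd ℂ)).2 ha')
  linear_combination b * h1 - b' * h

/-- Randomness of g enters only through the two conditions `hg0` and `hg`: nonvanishing entries for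
polarization, and general position for recovering a signal from M coefficients. -/
theorem isPhaseRetrievable_windowFamily {M : ℕ} [NeZero M] {C : ℝ} (hC : 3 < C)
    {T P : Finset (ZMod M)} (hT : T.card = min ⌊C⌋₊ M) (hP : IsPseudorandom C P) {g : Signal M}
    (hg0 : ∀ m, g m ≠ 0)
    (hg : ∀ e : ZMod M → ZMod M × ZMod M, Function.Injective e → (gaborMatrix e g).det ≠ 0) :
    IsPhaseRetrievable (gaborSystem (windowFamily g (T - T) P) (T ×ˢ Finset.univ)) := by
  classical
  have hMpos := NeZero.pos M
  refine isPhaseRetrievable_of_injective _ fun x y hxy => ?_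
  set Lam : Finset (ZMod M × ZMod M) := T ×ˢ Finset.univ with hLam
  have hLamcard : Lam.card = T.card * M := by
    rw [hLam, Finset.card_product, Finset.card_univ, ZMod.card]
  have hMLam : M ≤ Lam.card := by
    have h3 : 3 ≤ ⌊C⌋₊ := Nat.le_floor (by exact_mod_cast hC.le)
    rw [hLamcard, hT]
    exact Nat.le_mul_of_pos_left _ (by omega)
  set a : Signal M → ZMod M × ZMod M → ℂ := fun x lam => inner ℂ (timeFreqShift lam g) x with ha
  have hnorm : ∀ lam ∈ Lam, ‖a x lam‖ = ‖a y lam‖ := by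
    intro lam hlam
    have := congrFun hxy (none, ⟨lam, hlam⟩)
    exact (sq_eq_sq₀ (norm_nonneg _) (norm_nonneg _)).1 this
  by_cases hx : x = 0
  · refine ⟨1, norm_one, ?_⟩
    rw [hx, smul_zero]
    refine eq_zero_of_inner_timeFreqShift_eq_zero hg hMLam fun lam hlam => ?_
    have := hnorm lam hlam
    simp only [ha, hx, inner_zero_right, norm_zero] at this
    exact norm_eq_zero.1 this.symm
  have hedge : ∀ v ∈ Lam, ∀ w ∈ Lam, w.2 - v.2 ∈ P →
      starRingEnd ℂ (a x w) * a x v = starRingEnd ℂ (a y w) * a y v := by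
    rintro ⟨k, l⟩ hv ⟨k', l'⟩ hw hp
    -- Taking all of T - T as shifts makes edges depend on the frequency difference alone.
    have hq : k' - k ∈ T - T :=
      Finset.sub_mem_sub (Finset.mem_product.1 hw).1 (Finset.mem_product.1 hv).1
    refine conj_mul_eq_of_norm_add_cube_roots (v := ZMod.stdAddChar (-(k * (l' - l))))
      (norm_ne_zero_iff.1 (by rw [norm_stdAddChar]; exact one_ne_zero)) fun t => ?_
    have := congrFun hxy (some (⟨k' - k, hq⟩, ⟨l' - l, hp⟩, t), ⟨(k, l), hv⟩)
    simp only [phaselessMap, gaborSystem, windowFamily, timeFreqShift_auxWindow hg0,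
      inner_add_left, inner_smul_left, add_sub_cancel] at this
    exact this
  set V := Lam.filter fun lam => a x lam ≠ 0 with hV
  have hVcard : T.card * M < V.card + M := by
    have h1 := Finset.card_filter_add_card_filter_not (s := Lam) fun lam => a x lam ≠ 0
    have h2 : (Lam.filter fun lam => ¬ a x lam ≠ 0).card < M := by
      by_contra! h
      refine hx (eq_zero_of_inner_timeFreqShift_eq_zero hg h fun lam hlam => ?_)
      simpa [ha] using (Finset.mem_filter.1 hlam).2
    rw [← hV, hLamcard] at h1
    omega
  obtain ⟨c, hc⟩ := exists_large_color_class hC hT hP (Finset.filter_subset _ _ : V ⊆ Lam) hVcard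
    (fun lam => a y lam / a x lam) fun v hv w hw hvw => by
      rw [Finset.mem_filter] at hv hw
      exact div_eq_div_of_norm_eq_of_conj_mul_eq hv.2 hw.2 (hnorm w hw.1) (hedge v hv.1 w hw.1 hvw)
  refine ⟨c, ?_, ?_⟩
  · obtain ⟨lam, hlam⟩ := Finset.card_pos.1 (hMpos.trans_le hc)
    rw [Finset.mem_filter, Finset.mem_filter] at hlam
    rw [← hlam.2, norm_div, hnorm lam hlam.1.1, div_self]
    rw [← hnorm lam hlam.1.1]
    exact norm_ne_zero_iff.2 hlam.1.2
  · rw [← sub_eq_zero]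
    refine eq_zero_of_inner_timeFreqShift_eq_zero hg hc fun lam hlam => ?_
    rw [Finset.mem_filter, Finset.mem_filter] at hlam
    have h := hlam.2
    rw [div_eq_iff hlam.1.2] at h
    rw [inner_sub_right, inner_smul_right]
    exact sub_eq_zero.2 h

/-! ### Phase retrieval from four windows by polynomial evaluation. -/

open Polynomial ComplexConjugate

/-- The generating polynomial `∑ x(m) X^m`. -/
noncomputable def signalPoly {M : ℕ} [NeZero M] (x : Signal M) : ℂ[X] :=
  ∑ m : ZMod M, C (x m) * X ^ m.val

/-- The polynomial `∑ \bar x(m) s^m X^{M-1-m}`, which equals `X^{M-1}` times the complex conjugate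
of `signalPoly x` on the circle `|z|² = s`. -/
noncomputable def reversedPoly {M : ℕ} [NeZero M] (x : Signal M) (s : ℂ) : ℂ[X] :=
  ∑ m : ZMod M, C (conj (x m) * s ^ m.val) * X ^ (M - 1 - m.val)

theorem coeff_signalPoly {M : ℕ} [NeZero M] (x : Signal M) (m : ZMod M) :
    (signalPoly x).coeff m.val = x m := by
  rw [signalPoly, finsetSum_coeff, Finset.sum_eq_single m]
  · simp
  · intro b _ hb
    rw [coeff_C_mul_X_pow, if_neg fun h => hb (ZMod.val_injective M h.symm)]
  · intro h
    exact absurd (Finset.mem_univ m) h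

theorem coeff_reversedPoly {M : ℕ} [NeZero M] (x : Signal M) (s : ℂ) (m : ZMod M) :
    (reversedPoly x s).coeff (M - 1 - m.val) = conj (x m) * s ^ m.val := by
  rw [reversedPoly, finsetSum_coeff, Finset.sum_eq_single m]
  · rw [coeff_C_mul_X_pow, if_pos rfl]
  · intro b _ hb
    rw [coeff_C_mul_X_pow, if_neg]
    intro h
    have h1 := ZMod.val_lt b
    have h2 := ZMod.val_lt m
    exact hb (ZMod.val_injective M (by omega))
  · intro h
    exact absurd (Finset.mem_univ m) h

theorem signalPoly_eq_zero_iff {M : ℕ} [NeZero M] {x : Signal M} : signalPoly x = 0 ↔ x = 0 := by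
  constructor
  · intro h
    ext m
    rw [← coeff_signalPoly, h, coeff_zero, PiLp.zero_apply]
  · rintro rfl
    simp [signalPoly]

theorem reversedPoly_one_eq_zero_iff {M : ℕ} [NeZero M] {x : Signal M} :
    reversedPoly x 1 = 0 ↔ x = 0 := by
  constructor
  · intro h
    ext m
    have := coeff_reversedPoly x 1 m
    rw [h, coeff_zero, one_pow, mul_one] at this
    exact (map_eq_zero _).1 this.symm
  · rintro rfl
    simp [reversedPoly]

theorem natDegree_signalPoly_le {M : ℕ} [NeZero M] (x : Signal M) :
    (signalPoly x).natDegree ≤ M - 1 := by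
  refine natDegree_sum_le_of_forall_le _ _ fun m _ => (natDegree_C_mul_X_pow_le _ _).trans ?_
  have := ZMod.val_lt m
  omega

theorem natDegree_reversedPoly_le {M : ℕ} [NeZero M] (x : Signal M) (s : ℂ) :
    (reversedPoly x s).natDegree ≤ M - 1 :=
  natDegree_sum_le_of_forall_le _ _ fun _ _ =>
    (natDegree_C_mul_X_pow_le _ _).trans (Nat.sub_le _ _)

theorem eval_signalPoly_mul_reversedPoly {M : ℕ} [NeZero M] (x : Signal M) {s z : ℂ}
    (hz : z * conj z = s) : (signalPoly x * reversedPoly x s).eval z =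
      z ^ (M - 1) * (‖(signalPoly x).eval z‖ : ℂ) ^ 2 := by
  have h : (reversedPoly x s).eval z = z ^ (M - 1) * conj ((signalPoly x).eval z) := by
    rw [reversedPoly, signalPoly, eval_finsetSum, eval_finsetSum, map_sum, Finset.mul_sum]
    refine Finset.sum_congr rfl fun m _ => ?_
    have hm : m.val + (M - 1 - m.val) = M - 1 := by
      have := ZMod.val_lt m
      omega
    simp only [eval_mul, eval_C, eval_pow, eval_X, map_mul, map_pow]
    rw [← hz, ← hm, pow_add, mul_pow, hm]
    ring
  rw [eval_mul, h, mul_left_comm, Complex.mul_conj']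

/-- A dilation of the variable changes the radius: with q = 4, data on the circle |z| = 1/2 become a
functional equation for the polynomial attached to the unit circle. -/
theorem reversedPoly_comp {M : ℕ} [NeZero M] (x : Signal M) {q : ℂ} (hq : q ≠ 0) :
    (reversedPoly x 1).comp (C q * X) = C (q ^ (M - 1)) * reversedPoly x q⁻¹ := by
  rw [reversedPoly, reversedPoly, Polynomial.sum_comp, Finset.mul_sum]
  refine Finset.sum_congr rfl fun m _ => ?_
  have hm : M - 1 - m.val + m.val = M - 1 := by
    have := ZMod.val_lt m
    omega
  rw [mul_comp, C_comp, X_pow_comp, mul_pow, ← mul_assoc, ← mul_assoc, ← C_pow, ← C_mul, ← C_mul,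
    one_pow, mul_one, inv_pow]
  congr 2
  rw [← hm, pow_add, hm]
  field_simp

/-- Agreement of `|p|` at `2M` points of a circle determines the autocorrelation polynomial. -/
theorem signalPoly_mul_reversedPoly_eq {M : ℕ} [NeZero M] {x y : Signal M} {r : ℝ} (hr : 0 < r)
    {η : ℂ} (hη : η ^ M = -1)
    (h1 : ∀ l : ZMod M, ‖(signalPoly x).eval (r * ZMod.stdAddChar l)‖ =
      ‖(signalPoly y).eval (r * ZMod.stdAddChar l)‖)
    (h2 : ∀ l : ZMod M, ‖(signalPoly x).eval (r * η * ZMod.stdAddChar l)‖ =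
      ‖(signalPoly y).eval (r * η * ZMod.stdAddChar l)‖) :
    signalPoly x * reversedPoly x (r ^ 2) = signalPoly y * reversedPoly y (r ^ 2) := by
  have hMpos := NeZero.pos M
  have hηnorm : ‖η‖ = 1 := by
    rw [← pow_eq_one_iff_of_nonneg (norm_nonneg η) (NeZero.ne M), ← norm_pow, hη, norm_neg,
      norm_one]
  -- The M-th roots of unity and their multiples by η have M-th powers 1 and -1, so they are 2M
  -- distinct points, more than the degree bound 2M - 2.
  let f : Bool × ZMod M → ℂ := fun j => r * (if j.1 then η else 1) * ZMod.stdAddChar j.2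
  have hr0 : (r : ℂ) ≠ 0 := by exact_mod_cast hr.ne'
  have hif : ∀ b : Bool, ‖(if b then η else 1 : ℂ)‖ = 1 := by
    intro b
    cases b <;> simp [hηnorm]
  have hf : Function.Injective f := by
    rintro ⟨b, l⟩ ⟨b', l'⟩ h
    simp only [f, mul_assoc] at h
    have h := mul_left_cancel₀ hr0 h
    have hχ : ∀ l : ZMod M, (ZMod.stdAddChar l : ℂ) ^ M = 1 := by
      intro l
      rw [← AddChar.map_nsmul_eq_pow, nsmul_eq_mul, CharP.cast_eq_zero, zero_mul,
        AddChar.map_zero_eq_one]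
    have hb : b = b' := by
      have hpow := congrArg (· ^ M) h
      simp only [mul_pow, hχ, mul_one] at hpow
      have h11 : (-1 : ℂ) ≠ 1 := by norm_num
      cases b <;> cases b' <;> simp_all [eq_comm]
    subst hb
    have hne : (if b then η else 1 : ℂ) ≠ 0 := norm_ne_zero_iff.1 (by rw [hif]; exact one_ne_zero)
    rw [ZMod.injective_stdAddChar (mul_left_cancel₀ hne h)]
  rw [← sub_eq_zero]
  refine eq_zero_of_natDegree_lt_card_of_eval_eq_zero _ hf (fun j => ?_) ?_
  · have hz : f j * conj (f j) = (r : ℂ) ^ 2 := by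
      rw [Complex.mul_conj']
      simp only [f, norm_mul, hif, norm_stdAddChar, Complex.norm_real, Real.norm_eq_abs, mul_one,
        abs_of_pos hr]
    rw [eval_sub, eval_signalPoly_mul_reversedPoly x hz, eval_signalPoly_mul_reversedPoly y hz]
    have : ‖(signalPoly x).eval (f j)‖ = ‖(signalPoly y).eval (f j)‖ := by
      obtain ⟨b, l⟩ := j
      cases b
      · simpa [f] using h1 l
      · simpa [f] using h2 l
    rw [this, sub_self]
  · have hdeg : ∀ x : Signal M,
        (signalPoly x * reversedPoly x (r ^ 2)).natDegree ≤ (M - 1) + (M - 1) := fun x =>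
      natDegree_mul_le.trans
        (add_le_add (natDegree_signalPoly_le x) (natDegree_reversedPoly_le x _))
    refine (natDegree_sub_le_of_le (hdeg x) (hdeg y)).trans_lt ?_
    rw [max_self, Fintype.card_prod, Fintype.card_bool, ZMod.card]
    omega

/-- Polynomials whose quotient is invariant under a dilation of infinite order are
proportional. -/
theorem exists_eq_C_mul_of_mul_comp_eq {A B : ℂ[X]} {q : ℂ} (hq : Function.Injective (q ^ · : ℕ → ℂ))
    (hA : A ≠ 0) (h : A * B.comp (C q * X) = B * A.comp (C q * X)) : ∃ c, B = C c * A := by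
  have hq0 : q ≠ 0 := by
    rintro rfl
    exact absurd (hq (a₁ := 1) (a₂ := 2) (by simp)) (by norm_num)
  -- Leading coefficients give q^{deg D} = q^{deg A}, and the powers of q are distinct.
  have hdeg : ∀ D : ℂ[X], D ≠ 0 → A * D.comp (C q * X) = D * A.comp (C q * X) →
      D.natDegree = A.natDegree := by
    intro D hD h
    have hX : (C q * X : ℂ[X]).natDegree ≠ 0 := by rw [natDegree_C_mul_X q hq0]; exact one_ne_zero
    have h' := congrArg leadingCoeff h
    rw [leadingCoeff_mul, leadingCoeff_mul, leadingCoeff_comp hX, leadingCoeff_comp hX,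
      leadingCoeff_C_mul_X, mul_left_comm] at h'
    exact hq (mul_left_cancel₀ (leadingCoeff_ne_zero.2 hA)
      (mul_left_cancel₀ (leadingCoeff_ne_zero.2 hD) h'))
  -- This c removes the coefficient of B - cA at deg A; but B - cA satisfies the same relation, so
  -- if nonzero it would have exactly that degree.
  set c := B.coeff A.natDegree / A.leadingCoeff
  refine ⟨c, ?_⟩
  by_contra hne
  have hD : B - C c * A ≠ 0 := sub_ne_zero.2 hne
  have hdegD := hdeg _ hD (by
    rw [sub_comp, mul_comp, C_comp, mul_sub, sub_mul, h]
    ring)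
  apply leadingCoeff_ne_zero.2 hD
  rw [leadingCoeff, hdegD, coeff_sub, coeff_C_mul, coeff_natDegree,
    div_mul_cancel₀ _ (leadingCoeff_ne_zero.2 hA), sub_self]

/-- The autocorrelations on the circles of radius `1` and `1/2` determine a signal up to a
unimodular factor. -/
theorem exists_unimodular_of_autocorrelation_eq {M : ℕ} [NeZero M] {x y : Signal M}
    (h1 : signalPoly x * reversedPoly x 1 = signalPoly y * reversedPoly y 1)
    (h2 : signalPoly x * reversedPoly x 4⁻¹ = signalPoly y * reversedPoly y 4⁻¹) :
    ∃ c : ℂ, ‖c‖ = 1 ∧ y = c • x := by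
  by_cases hx : x = 0
  · rw [signalPoly_eq_zero_iff.2 hx, zero_mul] at h1
    have hy : y = 0 := by
      rcases mul_eq_zero.1 h1.symm with h | h
      · exact signalPoly_eq_zero_iff.1 h
      · exact reversedPoly_one_eq_zero_iff.1 h
    exact ⟨1, norm_one, by rw [hx, hy, smul_zero]⟩
  have hPx : signalPoly x ≠ 0 := mt signalPoly_eq_zero_iff.1 hx
  have hRx : reversedPoly x 1 ≠ 0 := mt reversedPoly_one_eq_zero_iff.1 hx
  have hPy : signalPoly y ≠ 0 := by
    intro h
    rw [h, zero_mul] at h1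
    exact mul_ne_zero hPx hRx h1
  have h4 : (4 : ℂ) ≠ 0 := by norm_num
  have hcomp : signalPoly x * (reversedPoly x 1).comp (C 4 * X)
      = signalPoly y * (reversedPoly y 1).comp (C 4 * X) := by
    rw [reversedPoly_comp x h4, reversedPoly_comp y h4, mul_left_comm, h2,
      mul_left_comm]
  have hinj : Function.Injective ((4 : ℂ) ^ · : ℕ → ℂ) := by
    intro a b hab
    have hab' : (4 : ℂ) ^ a = 4 ^ b := hab
    exact Nat.pow_right_injective (le_refl 2 |>.trans (by norm_num) : 2 ≤ 4)
      (by exact_mod_cast hab')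
  -- Combining the identities for the two circles eliminates `signalPoly` and shows that the
  -- quotient of the reversed polynomials is invariant under z ↦ 4z.
  obtain ⟨c, hc⟩ := exists_eq_C_mul_of_mul_comp_eq hinj hRx (B := reversedPoly y 1) (by
    apply mul_left_cancel₀ (mul_ne_zero hPx hPy)
    linear_combination (signalPoly y * (reversedPoly y 1).comp (C 4 * X)) * h1
      - (signalPoly y * reversedPoly y 1) * hcomp)
  have hyx : y = conj c • x := by
    ext m
    have h := congrArg (coeff · (M - 1 - m.val)) hc
    simp only [coeff_C_mul, coeff_reversedPoly, one_pow, mul_one] at h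
    have h' := congrArg conj h
    rw [map_mul, Complex.conj_conj, Complex.conj_conj] at h'
    rw [PiLp.smul_apply, smul_eq_mul, h']
  refine ⟨conj c, ?_, hyx⟩
  have hPyx : signalPoly y = C (conj c) * signalPoly x := by
    rw [hyx, signalPoly, signalPoly, Finset.mul_sum]
    refine Finset.sum_congr rfl fun m _ => ?_
    rw [PiLp.smul_apply, smul_eq_mul, C_mul, mul_assoc]
  rw [hPyx, hc] at h1
  have h3 : C (c * conj c) * (signalPoly x * reversedPoly x 1)
      = C 1 * (signalPoly x * reversedPoly x 1) := by
    rw [C_mul, C_1, one_mul]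
    linear_combination -h1
  have h5 := C_injective (mul_right_cancel₀ (mul_ne_zero hPx hRx) h3)
  rw [Complex.mul_conj'] at h5
  rw [RCLike.norm_conj, ← pow_eq_one_iff_of_nonneg (norm_nonneg c) two_ne_zero]
  exact_mod_cast h5

/-- The window whose shift by `(k, l)` evaluates `signalPoly` at `w e^{-2πi l / M}`. -/
noncomputable def evaluationWindow {M : ℕ} [NeZero M] (k : ZMod M) (w : ℂ) : Signal M :=
  WithLp.toLp 2 fun m => conj (w ^ (m + k).val)

theorem inner_timeFreqShift_evaluationWindow {M : ℕ} [NeZero M] (k l : ZMod M) (w : ℂ)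
    (x : Signal M) : inner ℂ (timeFreqShift (k, l) (evaluationWindow k w)) x =
      (signalPoly x).eval (w * ZMod.stdAddChar (-l)) := by
  rw [PiLp.inner_apply, signalPoly, eval_finsetSum]
  refine Finset.sum_congr rfl fun m _ => ?_
  rw [RCLike.inner_apply, timeFreqShift_apply, map_mul, conj_stdAddChar]
  simp only [evaluationWindow, sub_add_cancel, Complex.conj_conj, eval_mul, eval_C, eval_pow,
    eval_X, mul_pow]
  rw [← AddChar.map_nsmul_eq_pow, nsmul_eq_mul, ZMod.natCast_zmod_val,
    show m * -l = -(l * m) by ring]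
  ring

/-- A phase retrievable Gabor frame with any number `n ≥ 4` of windows. -/
theorem exists_isPhaseRetrievable_of_four_le {M : ℕ} [NeZero M] {T : Finset (ZMod M)}
    (hT : T.Nonempty) {n : ℕ} (hn : 4 ≤ n) :
    ∃ G : Fin n → Signal M, IsPhaseRetrievable (gaborSystem G (T ×ˢ Finset.univ)) := by
  obtain ⟨k, hk⟩ := hT
  set η : ℂ := Complex.exp (Real.pi * Complex.I / M) with hη
  have hηM : η ^ M = -1 := by
    have hM : (M : ℂ) ≠ 0 := by exact_mod_cast NeZero.ne M
    rw [hη, ← Complex.exp_nat_mul, mul_div_cancel₀ _ hM, Complex.exp_pi_mul_I]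
  -- The first four indices run over the radii 1 and 1/2 and the cosets of 1 and η; later windows
  -- only add redundant data.
  let w : ℕ → ℂ := fun i => (if i < 2 then 1 else 2⁻¹ : ℝ) * (if i % 2 = 0 then 1 else η)
  refine ⟨fun i => evaluationWindow k (w i), isPhaseRetrievable_of_injective _ fun x y hxy => ?_⟩
  have hmeas : ∀ i < 4, ∀ l : ZMod M, ‖(signalPoly x).eval (w i * ZMod.stdAddChar l)‖ =
      ‖(signalPoly y).eval (w i * ZMod.stdAddChar l)‖ := by
    intro i hi l
    have := congrFun hxy (⟨i, hi.trans_le hn⟩,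
      ⟨(k, -l), Finset.mem_product.2 ⟨hk, Finset.mem_univ _⟩⟩)
    simp only [phaselessMap, gaborSystem, inner_timeFreqShift_evaluationWindow, neg_neg] at this
    exact (sq_eq_sq₀ (norm_nonneg _) (norm_nonneg _)).1 this
  have h1 := signalPoly_mul_reversedPoly_eq (x := x) (y := y) one_pos hηM
    (by simpa [w] using hmeas 0 (by norm_num)) (by simpa [w] using hmeas 1 (by norm_num))
  have h2 := signalPoly_mul_reversedPoly_eq (x := x) (y := y) (r := 2⁻¹) (by norm_num) hηM
    (by simpa [w] using hmeas 2 (by norm_num)) (by simpa [w] using hmeas 3 (by norm_num))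
  refine exists_unimodular_of_autocorrelation_eq (by simpa using h1) ?_
  have e : ((2⁻¹ : ℝ) : ℂ) ^ 2 = 4⁻¹ := by
    push_cast
    norm_num
  rwa [e] at h2

end GaborPhase

/-! ### The main theorem. -/

theorem mainTheorem2 (M : ℕ) [NeZero M] (C : ℝ) (hC : 3 < C)
    (T : Finset (ZMod M)) (hT : T.card = min ⌊C⌋₊ M) :
    (∃ G : Fin (1 + 3 * GaborPhase.beta M C) → GaborPhase.Signal M,
      GaborPhase.IsPhaseRetrievable (GaborPhase.gaborSystem G (T ×ˢ Finset.univ))) ∧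
    (Fintype.card (Fin (1 + 3 * GaborPhase.beta M C) ×
        (T ×ˢ Finset.univ : Finset (ZMod M × ZMod M))) : ℝ)
      ≤ C * M * (1 + 3 * GaborPhase.beta M C) ∧
    (∀ P : Finset (ZMod M), GaborPhase.IsPseudorandom C P → P.card = GaborPhase.beta M C →
      ∀ᵐ g : Metric.sphere (0 : GaborPhase.Signal M) 1 ∂(GaborPhase.uniformSphere M),
        GaborPhase.IsPhaseRetrievable (GaborPhase.gaborSystem
          (GaborPhase.windowFamily (g : GaborPhase.Signal M) (T - T) P)
          (T ×ˢ Finset.univ))) := by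
  have h3 : 3 ≤ ⌊C⌋₊ := Nat.le_floor (by exact_mod_cast hC.le)
  refine ⟨?_, ?_, fun P hP _ => ?_⟩
  · have hTne : T.Nonempty := by
      have := NeZero.pos M
      exact Finset.card_pos.1 (by omega)
    obtain ⟨P, hP, hcard⟩ := (GaborPhase.beta_isLeast M C hC).1
    -- A minimizer is nonempty, so β ≥ 1 and at least four windows are available.
    have hPpos := hP.1.card_pos
    exact GaborPhase.exists_isPhaseRetrievable_of_four_le hTne (by omega)
  · have hTC : (T.card : ℝ) ≤ C := by
      calc (T.card : ℝ) ≤ ⌊C⌋₊ := by exact_mod_cast hT ▸ min_le_left _ _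
        _ ≤ C := Nat.floor_le (by linarith)
    rw [Fintype.card_prod, Fintype.card_fin, Fintype.card_coe, Finset.card_product,
      Finset.card_univ, ZMod.card]
    push_cast
    rw [mul_comm]
    gcongr
  · filter_upwards [GaborPhase.ae_uniformSphere_generic M] with g hg
    exact GaborPhase.isPhaseRetrievable_windowFamily hC hT hP hg.1 hg.2
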